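/- Let $d\in\mathbb N$ and $s>1$. For a multi-index $\beta\in\mathbb N^d$, a set $K\subseteq\mathbb R^d$, $A>0$ and a function $\varphi\in C^\infty(\mathbb R^d)$ put $$\|\varphi\|_{s,A,K}=\sup_{\beta}\sup_{x\in K}\frac{A^{|\beta|}}{\beta!^s}|\partial^\beta\varphi(x)|,\qquad \|\varphi\|_{s,A}=\sup_{\alpha,\beta}\sup_{x\in\mathbb R^d}\frac{A^{|\alpha+\beta|}}{\alpha!^s\beta!^s}\langle x\rangle^{|\alpha|}|\partial^\beta\varphi(x)|,\qquad \langle x\rangle=(1+|x|^2)^{1/2}.$$ Let - $\mathcal S^{(s)}(\mathbb R^d)$ be the space of $\varphi\in C^\infty(\mathbb R^d)$ with $\|\varphi\|_{s,A}<\infty$ for every $A>0$; - $\mathcal D^{(s)}(\mathbb R^d)$ be the space of compactly supported $\varphi\in C^\infty(\mathbb R^d)$ with $\|\varphi\|_{s,A,\operatorname{supp}\varphi}<\infty$ for every $A>0$, and $(\mathcal D^{(s)})'(\mathbb R^d)$ its dual: the linear functionals $f$ such that for every compact $K$ there are $A,C>0$ with $|f(\varphi)|\le C\|\varphi\|_{s,A,K}$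 for all $\varphi\in\mathcal D^{(s)}(\mathbb R^d)$ with $\operatorname{supp}\varphi\subseteq K$; - $\mathcal E^{\{s\}}(\mathbb R^d)$ be the (Roumieu) space of $\varphi\in C^\infty(\mathbb R^d)$ such that for every compact $K$ there is $A>0$ with $\|\varphi\|_{s,A,K}<\infty$, and $(\mathcal E^{\{s\}})'(\mathbb R^d)$ its dual: the linear functionals $f$ for which there is a compact $K$ such that for every $A>0$ there is $C>0$ with $|f(\varphi)|\le C\|\varphi\|_{s,A,K}$ for all $\varphi\in\mathcal E^{\{s\}}(\mathbb R^d)$ with $\|\varphi\|_{s,A,K}<\infty$. An element of $(\mathcal D^{(s)})'(\mathbb R^d)$ is said to lie in $(\mathcal E^{\{s\}})'(\mathbb R^d)$ if it is the restriction to $\mathcal D^{(s)}(\mathbb R^d)\subseteq\mathcal E^{\{s\}}(\mathbb R^d)$ of an element of $(\mathcal E^{\{s\}})'(\mathbb R^d)$. The short-time Fourier transform of $f$ with window $\phi$ is $$V_\phi f(x,\xi)=(2\pi)^{-d/2}\,\big\langle f,\ \overline{\phi(\,\cdot\,-x)}\,e^{-i\langle\xi,\,\cdot\,\rangle}\big\rangle,\qquad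 x,\xi\in\mathbb R^d,$$ where $\langle f,\varphi\rangle=f(\varphi)$ is the bilinear pairing. Then the following holds. 1. If $f\in(\mathcal E^{\{s\}})'(\mathbb R^d)$ and $\phi\in\mathcal S^{(s)}(\mathbb R^d)$, then for every $h>0$ and every $\varepsilon>0$ there is $C>0$ such that $$|V_\phi f(x,\xi)|\le C\,e^{-h|x|^{1/s}}e^{\varepsilon|\xi|^{1/s}}\qquad\text{for all }x,\xi\in\mathbb R^d.$$ 2. If $f\in(\mathcal D^{(s)})'(\mathbb R^d)$ and $\phi\in\mathcal D^{(s)}(\mathbb R^d)\setminus 0$, then $f\in(\mathcal E^{\{s\}})'(\mathbb R^d)$ if and only if both of the following hold: $\operatorname{supp}V_\phi f\subseteq K\times\mathbb R^d$ for some compact set $K\subseteq\mathbb R^d$, and for every $\varepsilon>0$ there is $C>0$ such that $|V_\phi f(x,\xi)|\le C\,e^{\varepsilon|\xi|^{1/s}}$ for all $x,\xi\in\mathbb R^d$. -/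

import Mathlib

open scoped ContDiff

noncomputable section

namespace UltraSTFT

/-- The Euclidean space `ℝ^d`. -/
abbrev Eu (d : ℕ) : Type := EuclideanSpace ℝ (Fin d)

/-- The order `|β| = β₁ + … + β_d` of a multi-index. -/
abbrev order {d : ℕ} (β : Fin d → ℕ) : ℕ := ∑ j, β j

/-- The multi-index factorial `β! = β₁! ⋯ β_d!`, as a real number. -/
def mfact {d : ℕ} (β : Fin d → ℕ) : ℝ := ∏ j, ((β j).factorial : ℝ)

/-- The directions `e₁, …, e₁, …, e_d, …, e_d`, where `e_j` is repeated `β_j` times. -/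
def dirs {d : ℕ} (β : Fin d → ℕ) : Fin (order β) → Eu d :=
  fun k => EuclideanSpace.single (finSigmaFinEquiv.symm k).1 1

/-- The partial derivative `∂^β φ = ∂₁^{β₁} ⋯ ∂_d^{β_d} φ` (of a smooth function). -/
def partialDeriv {d : ℕ} (β : Fin d → ℕ) (φ : Eu d → ℂ) (x : Eu d) : ℂ :=
  iteratedFDeriv ℝ (order β) φ x (dirs β)

/-- `‖φ‖_{s,A,K} = sup_β sup_{x ∈ K} A^{|β|} / β!^s * |∂^β φ(x)|`, with values in `[0, ∞]`. -/
def gevreyNorm {d : ℕ} (s A : ℝ) (K : Set (Eu d)) (φ : Eu d → ℂ) : ENNReal :=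
  ⨆ β : Fin d → ℕ, ⨆ x ∈ K,
    ENNReal.ofReal (A ^ order β / mfact β ^ s * ‖partialDeriv β φ x‖)

/-- `‖φ‖_{s,A} = sup_{α,β} sup_x A^{|α+β|} / (α!^s β!^s) * ⟨x⟩^{|α|} * |∂^β φ(x)|`,
where `⟨x⟩ = (1 + |x|^2)^{1/2}`, with values in `[0, ∞]`. -/
def gelfandShilovNorm {d : ℕ} (s A : ℝ) (φ : Eu d → ℂ) : ENNReal :=
  ⨆ α : Fin d → ℕ, ⨆ β : Fin d → ℕ, ⨆ x : Eu d,
    ENNReal.ofReal (A ^ order (α + β) / (mfact α ^ s * mfact β ^ s) *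
      √(1 + ‖x‖ ^ 2) ^ order α * ‖partialDeriv β φ x‖)

/-! ### Facts on partial derivatives -/

section Aux

variable {d : ℕ}

theorem mfact_pos (β : Fin d → ℕ) : 0 < mfact β :=
  Finset.prod_pos fun _ _ => by positivity

theorem one_le_mfact (β : Fin d → ℕ) : 1 ≤ mfact β := by
  unfold mfact
  exact_mod_cast Nat.one_le_iff_ne_zero.2
    (Finset.prod_ne_zero_iff.2 fun j _ => (β j).factorial_ne_zero)

theorem mfact_le (β : Fin d → ℕ) : mfact β ≤ ((order β).factorial : ℝ) := by
  unfold mfact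
  exact_mod_cast Nat.le_of_dvd (Nat.factorial_pos _) (Nat.prod_factorial_dvd_factorial_sum _ _)

theorem factorial_le_mfact (β : Fin d → ℕ) :
    ((order β).factorial : ℝ) ≤ (d : ℝ) ^ order β * mfact β := by
  have h1 := Nat.multinomial_spec Finset.univ β
  have h2 : Nat.multinomial Finset.univ β ≤ d ^ order β := by
    have h := Finset.sum_pow_eq_sum_piAntidiag (Finset.univ : Finset (Fin d))
      (fun _ => (1 : ℕ)) (order β)
    simp only [Finset.sum_const, Finset.card_univ, Fintype.card_fin, smul_eq_mul, mul_one,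
      one_pow, Finset.prod_const_one, Nat.cast_id] at h
    rw [h]
    exact Finset.single_le_sum (f := fun k => Nat.multinomial Finset.univ k)
      (fun _ _ => Nat.zero_le _) (by simp)
  unfold mfact
  have h3 : (order β).factorial ≤ d ^ order β * ∏ j, (β j).factorial := by
    rw [← h1, mul_comm]
    exact Nat.mul_le_mul_right _ h2
  exact_mod_cast h3

theorem partialDeriv_add {φ ψ : Eu d → ℂ} (hφ : ContDiff ℝ ∞ φ) (hψ : ContDiff ℝ ∞ ψ)
    (β : Fin d → ℕ) (x : Eu d) :
    partialDeriv β (φ + ψ) x = partialDeriv β φ x + partialDeriv β ψ x := by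
  have h : ((order β : ℕ) : WithTop ℕ∞) ≤ ∞ := by exact_mod_cast le_top
  unfold partialDeriv
  rw [iteratedFDeriv_add_apply (hφ.of_le h).contDiffAt (hψ.of_le h).contDiffAt]
  rfl

theorem partialDeriv_smul {φ : Eu d → ℂ} (hφ : ContDiff ℝ ∞ φ) (c : ℂ)
    (β : Fin d → ℕ) (x : Eu d) :
    partialDeriv β (c • φ) x = c * partialDeriv β φ x := by
  have h : ((order β : ℕ) : WithTop ℕ∞) ≤ ∞ := by exact_mod_cast le_top
  unfold partialDeriv
  rw [iteratedFDeriv_const_smul_apply (hφ.of_le h).contDiffAt]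
  rfl

theorem norm_partialDeriv_le (β : Fin d → ℕ) (φ : Eu d → ℂ) (x : Eu d) :
    ‖partialDeriv β φ x‖ ≤ ‖iteratedFDeriv ℝ (order β) φ x‖ := by
  have h := (iteratedFDeriv ℝ (order β) φ x).le_opNorm (dirs β)
  simpa [partialDeriv, dirs] using h

/-- Iterated directional derivatives. -/
def listDeriv (l : List (Eu d)) (φ : Eu d → ℂ) : Eu d → ℂ :=
  l.foldr (fun v g x => fderiv ℝ g x v) φ

theorem contDiff_listDeriv {φ : Eu d → ℂ} (hφ : ContDiff ℝ ∞ φ) (l : List (Eu d)) :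
    ContDiff ℝ ∞ (listDeriv l φ) := by
  induction l with
  | nil => exact hφ
  | cons v l ih =>
    change ContDiff ℝ ∞ (fun x => fderiv ℝ (listDeriv l φ) x v)
    exact (ih.fderiv_right (m := ∞) (by simp)).clm_apply contDiff_const

theorem listDeriv_perm {φ : Eu d → ℂ} (hφ : ContDiff ℝ ∞ φ) {l l' : List (Eu d)}
    (h : l.Perm l') : listDeriv l φ = listDeriv l' φ := by
  induction h with
  | nil => rfl
  | cons v _ ih =>
    change (fun x => fderiv ℝ (listDeriv _ φ) x v) = (fun x => fderiv ℝ (listDeriv _ φ) x v)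
    rw [ih]
  | swap v w l =>
    have hg := contDiff_listDeriv hφ l
    set g := listDeriv l φ with hgdef
    change (fun x => fderiv ℝ (fun y => fderiv ℝ g y v) x w) =
      (fun x => fderiv ℝ (fun y => fderiv ℝ g y w) x v)
    funext x
    have hd : DifferentiableAt ℝ (fderiv ℝ g) x :=
      ((hg.fderiv_right (m := ∞) (by simp)).differentiable (by simp)) x
    rw [fderiv_clm_apply hd (differentiableAt_const _),
      fderiv_clm_apply hd (differentiableAt_const _)]
    have hs : IsSymmSndFDerivAt ℝ g x := hg.contDiffAt.isSymmSndFDerivAt (by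
      rw [minSmoothness_of_isRCLikeNormedField]
      exact WithTop.coe_le_coe.2 le_top)
    simpa using hs w v
  | trans _ _ ih1 ih2 => rw [ih1, ih2]

theorem iteratedFDeriv_eq_listDeriv {φ : Eu d → ℂ} (hφ : ContDiff ℝ ∞ φ) (n : ℕ)
    (v : Fin n → Eu d) (x : Eu d) :
    iteratedFDeriv ℝ n φ x v = listDeriv (List.ofFn v) φ x := by
  induction n generalizing x with
  | zero => simp [listDeriv]
  | succ n ih =>
    rw [iteratedFDeriv_succ_apply_left, List.ofFn_succ]
    change _ = fderiv ℝ (listDeriv (List.ofFn fun i => v i.succ) φ) x (v 0)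
    have h1 : listDeriv (List.ofFn fun i => v i.succ) φ =
        fun y => iteratedFDeriv ℝ n φ y (fun i => v i.succ) := by
      funext y; exact (ih _ y).symm
    have hd : DifferentiableAt ℝ (iteratedFDeriv ℝ n φ) x :=
      (hφ.differentiable_iteratedFDeriv (by exact_mod_cast WithTop.coe_lt_top _)) x
    rw [h1]
    have h2 := ((ContinuousMultilinearMap.apply ℝ (fun _ : Fin n => Eu d) ℂ
      (fun i => v i.succ)).hasFDerivAt.comp x hd.hasFDerivAt).fderiv
    have h3 : (fun y => iteratedFDeriv ℝ n φ y (fun i => v i.succ)) =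
      (ContinuousMultilinearMap.apply ℝ (fun _ : Fin n => Eu d) ℂ
      (fun i => v i.succ)) ∘ iteratedFDeriv ℝ n φ := rfl
    rw [h3, h2]
    rfl

theorem iteratedFDeriv_single_eq {φ : Eu d → ℂ} (hφ : ContDiff ℝ ∞ φ) (n : ℕ)
    (v : Fin n → Fin d) :
    ∃ β : Fin d → ℕ, order β = n ∧ ∀ x, iteratedFDeriv ℝ n φ x
      (fun k => EuclideanSpace.single (v k) 1) = partialDeriv β φ x := by
  classical
  refine ⟨fun j => (Finset.univ.filter fun k => v k = j).card, ?_, fun x => ?_⟩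
  · have := Finset.card_eq_sum_card_fiberwise (f := v) (s := Finset.univ) (t := Finset.univ)
      (by intro _ _; simp)
    simpa [order] using this.symm
  · rw [partialDeriv, iteratedFDeriv_eq_listDeriv hφ, iteratedFDeriv_eq_listDeriv hφ]
    refine congrFun (listDeriv_perm hφ ?_) x
    set β : Fin d → ℕ := fun j => (Finset.univ.filter fun k => v k = j).card with hβ
    have e1 : (List.ofFn fun k => (EuclideanSpace.single (v k) 1 : Eu d)) =
      (List.ofFn v).map (fun j => EuclideanSpace.single j 1) := by
      rw [List.map_ofFn]; rfl
    have e2 : List.ofFn (dirs β) = (List.ofFn fun k : Fin (order β) =>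
        (finSigmaFinEquiv.symm k).1).map (fun j => (EuclideanSpace.single j 1 : Eu d)) := by
      rw [List.map_ofFn]; rfl
    rw [e1, e2]
    refine List.Perm.map _ ?_
    have hcount : ∀ (m : ℕ) (w : Fin m → Fin d) (j : Fin d),
        (List.ofFn w).count j = (Finset.univ.filter fun k => w k = j).card := by
      intro m w j
      rw [List.ofFn_eq_map, List.count, List.countP_map, Finset.card_def, Finset.filter_val]
      rw [← Multiset.countP_eq_card_filter]
      change _ = Multiset.countP _ ((List.finRange m : List (Fin m)) : Multiset (Fin m))
      rw [Multiset.coe_countP]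
      congr 1
    rw [List.perm_iff_count]
    intro j
    rw [hcount, hcount]
    have : (Finset.univ.filter fun k : Fin (order β) => (finSigmaFinEquiv.symm k).1 = j).card
        = (Finset.univ.filter fun p : (i : Fin d) × Fin (β i) => p.1 = j).card := by
      refine Finset.card_equiv finSigmaFinEquiv.symm ?_
      intro k; simp
    rw [this]
    have h5 : (Finset.univ.filter fun p : (i : Fin d) × Fin (β i) => p.1 = j) =
        (Finset.univ : Finset (Fin (β j))).map (Function.Embedding.sigmaMk j) := by
      ext ⟨i, k⟩
      simp only [Finset.mem_filter, Finset.mem_univ, true_and, Finset.mem_map,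
        Function.Embedding.sigmaMk_apply]
      constructor
      · rintro rfl; exact ⟨k, rfl⟩
      · rintro ⟨a, h⟩; exact (congrArg Sigma.fst h).symm
    rw [h5, Finset.card_map, Finset.card_fin]

theorem norm_iteratedFDeriv_le {φ : Eu d → ℂ} (hφ : ContDiff ℝ ∞ φ) (n : ℕ) (x : Eu d)
    {M : ℝ} (hM : 0 ≤ M) (h : ∀ β : Fin d → ℕ, order β = n → ‖partialDeriv β φ x‖ ≤ M) :
    ‖iteratedFDeriv ℝ n φ x‖ ≤ (d : ℝ) ^ n * M := by
  refine ContinuousMultilinearMap.opNorm_le_bound (by positivity) fun m => ?_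
  have hm : m = fun k => ∑ j, (m k) j • (EuclideanSpace.single j 1 : Eu d) := by
    funext k
    have := (EuclideanSpace.basisFun (Fin d) ℝ).sum_repr (m k)
    simpa using this.symm
  have h1 : iteratedFDeriv ℝ n φ x m = ∑ r : Fin n → Fin d,
      (∏ k, (m k) (r k)) • iteratedFDeriv ℝ n φ x
        (fun k => EuclideanSpace.single (r k) 1) := by
    conv_lhs => rw [hm]
    rw [← ContinuousMultilinearMap.coe_coe, MultilinearMap.map_sum]
    refine Finset.sum_congr rfl fun r _ => ?_
    rw [MultilinearMap.map_smul_univ]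
  rw [h1]
  have h2 : ∀ r ∈ (Finset.univ : Finset (Fin n → Fin d)),
      ‖(∏ k, (m k) (r k)) • iteratedFDeriv ℝ n φ x
        (fun k => EuclideanSpace.single (r k) 1)‖ ≤ (∏ k, ‖m k‖) * M := by
    intro r _
    obtain ⟨β, hβ, hr⟩ := iteratedFDeriv_single_eq hφ n r
    rw [norm_smul, hr, norm_prod]
    refine mul_le_mul (Finset.prod_le_prod (fun _ _ => norm_nonneg _) fun k _ => ?_) (h β hβ)
      (norm_nonneg _) (Finset.prod_nonneg fun _ _ => norm_nonneg _)
    exact PiLp.norm_apply_le (m k) (r k)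
  refine (norm_sum_le_of_le _ h2).trans (le_of_eq ?_)
  simp
  ring

theorem gevreyNorm_lt_top_iff {s A : ℝ} {K : Set (Eu d)} {φ : Eu d → ℂ} :
    gevreyNorm s A K φ < ⊤ ↔ ∃ C : ℝ, 0 ≤ C ∧ ∀ β : Fin d → ℕ, ∀ x ∈ K,
      A ^ order β / mfact β ^ s * ‖partialDeriv β φ x‖ ≤ C := by
  constructor
  · intro h
    refine ⟨(gevreyNorm s A K φ).toReal, ENNReal.toReal_nonneg, fun β x hx => ?_⟩
    have h1 : ENNReal.ofReal (A ^ order β / mfact β ^ s * ‖partialDeriv β φ x‖) ≤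
        gevreyNorm s A K φ :=
      (le_iSup₂ (f := fun x (_ : x ∈ K) =>
        ENNReal.ofReal (A ^ order β / mfact β ^ s * ‖partialDeriv β φ x‖)) x hx).trans
        (le_iSup (fun β : Fin d → ℕ => ⨆ x ∈ K,
          ENNReal.ofReal (A ^ order β / mfact β ^ s * ‖partialDeriv β φ x‖)) β)
    exact (ENNReal.ofReal_le_iff_le_toReal h.ne).1 h1
  · rintro ⟨C, _, h⟩
    refine lt_of_le_of_lt ?_ (ENNReal.ofReal_lt_top (r := C))
    exact iSup_le fun β => iSup₂_le fun x hx => ENNReal.ofReal_le_ofReal (h β x hx)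

theorem partialDeriv_eq_zero {φ : Eu d → ℂ} {x : Eu d} (hx : x ∉ tsupport φ)
    (β : Fin d → ℕ) : partialDeriv β φ x = 0 := by
  have h : iteratedFDeriv ℝ (order β) φ x = 0 := by
    by_contra h
    exact hx (support_iteratedFDeriv_subset (𝕜 := ℝ) (order β) h)
  simp [partialDeriv, h]

theorem gevreyNorm_le_of_tsupport {s A : ℝ} {K L : Set (Eu d)} {φ : Eu d → ℂ}
    (h : tsupport φ ⊆ K) : gevreyNorm s A L φ ≤ gevreyNorm s A K φ := by
  refine iSup_mono fun β => iSup₂_le fun x _ => ?_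
  by_cases hx : x ∈ K
  · exact le_iSup₂ (f := fun x (_ : x ∈ K) =>
        ENNReal.ofReal (A ^ order β / mfact β ^ s * ‖partialDeriv β φ x‖)) x hx
  · rw [partialDeriv_eq_zero (fun h' => hx (h h'))]
    simp

theorem gevreyNorm_add_lt_top {s A : ℝ} (hA : 0 < A) {K : Set (Eu d)} {φ ψ : Eu d → ℂ}
    (hφ : ContDiff ℝ ∞ φ) (hψ : ContDiff ℝ ∞ ψ)
    (h1 : gevreyNorm s A K φ < ⊤) (h2 : gevreyNorm s A K ψ < ⊤) :
    gevreyNorm s A K (φ + ψ) < ⊤ := by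
  rw [gevreyNorm_lt_top_iff] at *
  obtain ⟨C, hC, h1⟩ := h1
  obtain ⟨C', hC', h2⟩ := h2
  refine ⟨C + C', by positivity, fun β x hx => ?_⟩
  have hm := mfact_pos β
  refine le_trans ?_ (add_le_add (h1 β x hx) (h2 β x hx))
  rw [partialDeriv_add hφ hψ, ← mul_add]
  exact mul_le_mul_of_nonneg_left (norm_add_le _ _) (by positivity)

theorem gevreyNorm_smul_lt_top {s A : ℝ} {K : Set (Eu d)} {φ : Eu d → ℂ}
    (hφ : ContDiff ℝ ∞ φ) (h : gevreyNorm s A K φ < ⊤) (c : ℂ) :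
    gevreyNorm s A K (c • φ) < ⊤ := by
  rw [gevreyNorm_lt_top_iff] at *
  obtain ⟨C, hC, h⟩ := h
  refine ⟨‖c‖ * C, by positivity, fun β x hx => ?_⟩
  rw [partialDeriv_smul hφ, norm_mul, mul_left_comm]
  exact mul_le_mul_of_nonneg_left (h β x hx) (norm_nonneg _)

theorem gevreyNorm_anti {s A B : ℝ} (hA : 0 < A) (hAB : A ≤ B) {K : Set (Eu d)}
    {φ : Eu d → ℂ} : gevreyNorm s A K φ ≤ gevreyNorm s B K φ := by
  refine iSup_mono fun β => iSup₂_mono fun x _ => ENNReal.ofReal_le_ofReal ?_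
  have hm := mfact_pos β
  gcongr

theorem gevreyNorm_mono_set {s A : ℝ} {K L : Set (Eu d)} (h : K ⊆ L)
    {φ : Eu d → ℂ} : gevreyNorm s A K φ ≤ gevreyNorm s A L φ :=
  iSup_mono fun _ => biSup_mono h

/-! ### Gevrey bounds for translated and modulated windows -/

theorem bound_of_gevreyNorm {s : ℝ} (hs : 1 < s) {φ : Eu d → ℂ} (hφ : ContDiff ℝ ∞ φ)
    (h : ∀ A : ℝ, 0 < A → gevreyNorm s A Set.univ φ < ⊤) (A : ℝ) (hA : 0 < A) :
    ∃ C : ℝ, 0 ≤ C ∧ ∀ n x, A ^ n * ‖iteratedFDeriv ℝ n φ x‖ ≤ C * (n.factorial : ℝ) ^ s := by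
  obtain ⟨C, hC, h⟩ := gevreyNorm_lt_top_iff.1 (h (A * (d + 1)) (by positivity))
  refine ⟨C, hC, fun n x => ?_⟩
  have h1 := norm_iteratedFDeriv_le hφ n x
    (M := C * (n.factorial : ℝ) ^ s / (A * (d + 1)) ^ n) (by positivity) (by
      intro β hβ
      have h2 := h β x (Set.mem_univ x)
      have hm := mfact_pos β
      have h3 : mfact β ^ s ≤ (n.factorial : ℝ) ^ s := by
        rw [← hβ]
        exact Real.rpow_le_rpow hm.le (mfact_le β) (by linarith)
      rw [hβ, div_mul_eq_mul_div, div_le_iff₀ (by positivity)] at h2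
      rw [le_div_iff₀ (by positivity), mul_comm]
      exact h2.trans (mul_le_mul_of_nonneg_left h3 hC))
  calc A ^ n * ‖iteratedFDeriv ℝ n φ x‖
      ≤ A ^ n * ((d : ℝ) ^ n * (C * (n.factorial : ℝ) ^ s / (A * (d + 1)) ^ n)) := by gcongr
    _ = ((d : ℝ) / (d + 1)) ^ n * (C * (n.factorial : ℝ) ^ s) := by
        rw [mul_pow, div_pow]; field_simp
    _ ≤ 1 * (C * (n.factorial : ℝ) ^ s) := by
        gcongr
        exact pow_le_one₀ (by positivity) (by rw [div_le_one (by positivity)]; linarith)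
    _ = _ := one_mul _

theorem gevreyNorm_of_bound {s : ℝ} (hs : 1 < s) {φ : Eu d → ℂ}
    (h : ∀ A : ℝ, 0 < A → ∃ C : ℝ, 0 ≤ C ∧
      ∀ n x, A ^ n * ‖iteratedFDeriv ℝ n φ x‖ ≤ C * (n.factorial : ℝ) ^ s)
    (A : ℝ) (hA : 0 < A) : gevreyNorm s A Set.univ φ < ⊤ := by
  have hd : (0 : ℝ) ≤ (d : ℝ) ^ s := by positivity
  obtain ⟨C, hC, h⟩ := h (A * ((d : ℝ) ^ s + 1)) (by positivity)
  refine gevreyNorm_lt_top_iff.2 ⟨C, hC, fun β x _ => ?_⟩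
  have hm := mfact_pos β
  set n := order β with hn
  have h2 := h n x
  have h3 : (n.factorial : ℝ) ^ s ≤ ((d : ℝ) ^ s) ^ n * mfact β ^ s := by
    have h4 := Real.rpow_le_rpow (by positivity) (factorial_le_mfact β)
      (show (0 : ℝ) ≤ s by linarith)
    rwa [Real.mul_rpow (by positivity) hm.le, ← Real.rpow_natCast, ← Real.rpow_mul (by positivity),
      mul_comm ((order β : ℕ) : ℝ) s, Real.rpow_mul (by positivity), Real.rpow_natCast] at h4
  have h5 : A ^ n * ‖partialDeriv β φ x‖ * ((d : ℝ) ^ s + 1) ^ n ≤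
      C * mfact β ^ s * ((d : ℝ) ^ s + 1) ^ n := by
    calc A ^ n * ‖partialDeriv β φ x‖ * ((d : ℝ) ^ s + 1) ^ n
        ≤ A ^ n * ‖iteratedFDeriv ℝ n φ x‖ * ((d : ℝ) ^ s + 1) ^ n := by
          gcongr; exact norm_partialDeriv_le β φ x
      _ = (A * ((d : ℝ) ^ s + 1)) ^ n * ‖iteratedFDeriv ℝ n φ x‖ := by rw [mul_pow]; ring
      _ ≤ C * (((d : ℝ) ^ s) ^ n * mfact β ^ s) := h2.trans (by gcongr)
      _ ≤ C * (((d : ℝ) ^ s + 1) ^ n * mfact β ^ s) := by gcongr; linarith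
      _ = _ := by ring
  have h6 := le_of_mul_le_mul_right h5 (by positivity)
  rw [div_mul_eq_mul_div, div_le_iff₀ (by positivity)]
  exact h6

theorem bound_mul {s : ℝ} (hs : 1 < s) {f g : Eu d → ℂ} (hf : ContDiff ℝ ∞ f)
    (hg : ContDiff ℝ ∞ g)
    (h1 : ∀ A : ℝ, 0 < A → ∃ C : ℝ, 0 ≤ C ∧
      ∀ n x, A ^ n * ‖iteratedFDeriv ℝ n f x‖ ≤ C * (n.factorial : ℝ) ^ s)
    (h2 : ∀ A : ℝ, 0 < A → ∃ C : ℝ, 0 ≤ C ∧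
      ∀ n x, A ^ n * ‖iteratedFDeriv ℝ n g x‖ ≤ C * (n.factorial : ℝ) ^ s)
    (A : ℝ) (hA : 0 < A) : ∃ C : ℝ, 0 ≤ C ∧
      ∀ n x, A ^ n * ‖iteratedFDeriv ℝ n (fun y => f y * g y) x‖ ≤
        C * (n.factorial : ℝ) ^ s := by
  obtain ⟨C, hC, h1⟩ := h1 (2 * A) (by positivity)
  obtain ⟨C', hC', h2⟩ := h2 (2 * A) (by positivity)
  refine ⟨C * C', by positivity, fun n x => ?_⟩
  have h3 := norm_iteratedFDeriv_mul_le hf hg x (n := n) (by exact_mod_cast le_top)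
  have h4 : (2 * A) ^ n * ‖iteratedFDeriv ℝ n (fun y => f y * g y) x‖ ≤
      2 ^ n * (C * C' * (n.factorial : ℝ) ^ s) := by
    calc (2 * A) ^ n * ‖iteratedFDeriv ℝ n (fun y => f y * g y) x‖
        ≤ (2 * A) ^ n * ∑ i ∈ Finset.range (n + 1), (n.choose i : ℝ) *
          ‖iteratedFDeriv ℝ i f x‖ * ‖iteratedFDeriv ℝ (n - i) g x‖ := by gcongr
      _ = ∑ i ∈ Finset.range (n + 1), (n.choose i : ℝ) *
          (((2 * A) ^ i * ‖iteratedFDeriv ℝ i f x‖) *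
            ((2 * A) ^ (n - i) * ‖iteratedFDeriv ℝ (n - i) g x‖)) := by
          rw [Finset.mul_sum]
          refine Finset.sum_congr rfl fun i hi => ?_
          have hi' : i ≤ n := Nat.lt_succ_iff.1 (Finset.mem_range.1 hi)
          rw [← Nat.add_sub_cancel' hi', pow_add]
          simp only [Nat.add_sub_cancel_left]
          ring
      _ ≤ ∑ i ∈ Finset.range (n + 1), (n.choose i : ℝ) *
          (C * C' * (n.factorial : ℝ) ^ s) := by
          refine Finset.sum_le_sum fun i hi => ?_
          have hi' : i ≤ n := Nat.lt_succ_iff.1 (Finset.mem_range.1 hi)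
          refine mul_le_mul_of_nonneg_left ?_ (by positivity)
          calc _ ≤ (C * (i.factorial : ℝ) ^ s) * (C' * ((n - i).factorial : ℝ) ^ s) :=
                mul_le_mul (h1 i x) (h2 (n - i) x) (by positivity) (by positivity)
            _ = C * C' * ((i.factorial : ℝ) * ((n - i).factorial : ℝ)) ^ s := by
                rw [Real.mul_rpow (by positivity) (by positivity)]; ring
            _ ≤ C * C' * (n.factorial : ℝ) ^ s := by
                have : (i.factorial : ℝ) * ((n - i).factorial : ℝ) ≤ (n.factorial : ℝ) := by
                  exact_mod_cast Nat.le_of_dvd (Nat.factorial_pos _)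
                    (Nat.factorial_mul_factorial_dvd_factorial hi')
                gcongr
      _ = 2 ^ n * (C * C' * (n.factorial : ℝ) ^ s) := by
          rw [← Finset.sum_mul]
          congr 1
          exact_mod_cast Nat.sum_range_choose n
  rw [mul_pow, mul_assoc] at h4
  exact le_of_mul_le_mul_left h4 (by positivity)

/-- The character `y ↦ exp(-i⟨ξ, y⟩)`. -/
def character (ξ y : Eu d) : ℂ := Complex.exp (-Complex.I * ((inner ℝ ξ y : ℝ) : ℂ))

theorem contDiff_character (ξ : Eu d) : ContDiff ℝ ∞ (character ξ) := by
  unfold character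
  have h : ContDiff ℝ ∞ fun y : Eu d => ((inner ℝ ξ y : ℝ) : ℂ) :=
    Complex.ofRealCLM.contDiff.comp (contDiff_const.inner ℝ contDiff_id)
  exact (contDiff_const.mul h).cexp

theorem norm_iteratedFDeriv_character_le (ξ : Eu d) (n : ℕ) (y : Eu d) :
    ‖iteratedFDeriv ℝ n (character ξ) y‖ ≤ ‖ξ‖ ^ n := by
  induction n with
  | zero =>
    rw [norm_iteratedFDeriv_zero, character, Complex.norm_exp]
    simp
  | succ n ih =>
    let L : Eu d →L[ℝ] ℂ := (-Complex.I) • (Complex.ofRealCLM.comp (innerSL ℝ ξ))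
    have hL : ‖L‖ ≤ ‖ξ‖ := by
      refine ContinuousLinearMap.opNorm_le_bound _ (norm_nonneg _) fun z => ?_
      simpa [L] using abs_real_inner_le_norm ξ z
    let M : ℂ →L[ℝ] (Eu d →L[ℝ] ℂ) :=
      (ContinuousLinearMap.lsmul ℝ ℂ : ℂ →L[ℝ] (Eu d →L[ℝ] ℂ) →L[ℝ] (Eu d →L[ℝ] ℂ)).flip L
    have hM : ‖M‖ ≤ ‖ξ‖ := by
      refine ContinuousLinearMap.opNorm_le_bound _ (norm_nonneg _) fun c => ?_
      change ‖c • L‖ ≤ _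
      rw [norm_smul, mul_comm]
      exact mul_le_mul_of_nonneg_right hL (norm_nonneg _)
    have hd : fderiv ℝ (character ξ) = M ∘ character ξ := by
      funext z
      have h1 : HasFDerivAt (character ξ) (Complex.exp (L z) • L) z :=
        (L.hasFDerivAt (x := z)).cexp
      exact h1.fderiv
    rw [← norm_iteratedFDeriv_fderiv, hd, pow_succ']
    exact (M.norm_iteratedFDeriv_comp_left (contDiff_character ξ).contDiffAt
      (by exact_mod_cast le_top)).trans (mul_le_mul hM ih (norm_nonneg _) (norm_nonneg _))

theorem bound_character {s : ℝ} (hs : 1 < s) (ξ : Eu d) (A : ℝ) (hA : 0 < A) :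
    ∃ C : ℝ, 0 ≤ C ∧ ∀ n x, A ^ n * ‖iteratedFDeriv ℝ n (character ξ) x‖ ≤
      C * (n.factorial : ℝ) ^ s := by
  refine ⟨Real.exp (A * ‖ξ‖), by positivity, fun n x => ?_⟩
  have h1 := Real.pow_div_factorial_le_exp (A * ‖ξ‖) (by positivity) n
  rw [div_le_iff₀ (by positivity)] at h1
  have h2 : (n.factorial : ℝ) ≤ (n.factorial : ℝ) ^ s :=
    Real.self_le_rpow_of_one_le (by exact_mod_cast Nat.factorial_pos n) hs.le
  calc A ^ n * ‖iteratedFDeriv ℝ n (character ξ) x‖ ≤ A ^ n * ‖ξ‖ ^ n := by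
        gcongr; exact norm_iteratedFDeriv_character_le ξ n x
    _ = (A * ‖ξ‖) ^ n := (mul_pow _ _ _).symm
    _ ≤ _ := h1.trans (by gcongr)

end Aux

/-! ### Test function spaces -/

/-- The space `𝒟^{(s)}(ℝ^d)`: smooth functions supported in some compact set `K` for which
`‖φ‖_{s,A,K}` is finite for every `A > 0`. -/
def BeurlingD (d : ℕ) (s : ℝ) : Submodule ℂ (Eu d → ℂ) where
  carrier := {φ | ContDiff ℝ ∞ φ ∧ ∃ K : Set (Eu d), IsCompact K ∧ tsupport φ ⊆ K ∧
    ∀ A : ℝ, 0 < A → gevreyNorm s A K φ < ⊤}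
  zero_mem' := by
    refine ⟨contDiff_const, ∅, isCompact_empty, by simp [tsupport], fun A _ => by
      simp [gevreyNorm]⟩
  add_mem' := by
    rintro φ ψ ⟨hφ, K, hK, hφK, h1⟩ ⟨hψ, L, hL, hψL, h2⟩
    refine ⟨hφ.add hψ, K ∪ L, hK.union hL, ?_, fun A hA => ?_⟩
    · exact (tsupport_add φ ψ).trans (Set.union_subset_union hφK hψL)
    · exact gevreyNorm_add_lt_top hA hφ hψ ((gevreyNorm_le_of_tsupport hφK).trans_lt (h1 A hA))
        ((gevreyNorm_le_of_tsupport hψL).trans_lt (h2 A hA))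
  smul_mem' := by
    rintro c φ ⟨hφ, K, hK, hφK, h⟩
    refine ⟨contDiff_const.smul hφ, K, hK, ?_, fun A hA => gevreyNorm_smul_lt_top hφ (h A hA) c⟩
    exact (closure_mono (Function.support_const_smul_subset c φ)).trans hφK

/-- The space `ℰ^{{s}}(ℝ^d)`: smooth functions such that for every compact set `K` there is
`A > 0` for which `‖φ‖_{s,A,K}` is finite. -/
def RoumieuE (d : ℕ) (s : ℝ) : Submodule ℂ (Eu d → ℂ) where
  carrier := {φ | ContDiff ℝ ∞ φ ∧ ∀ K : Set (Eu d), IsCompact K →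
    ∃ A : ℝ, 0 < A ∧ gevreyNorm s A K φ < ⊤}
  zero_mem' := by
    refine ⟨contDiff_const, fun K _ => ⟨1, one_pos, ?_⟩⟩
    refine lt_of_le_of_lt (gevreyNorm_le_of_tsupport (K := ∅) ?_) ?_
    · simp [tsupport]
    · simp [gevreyNorm]
  add_mem' := by
    rintro φ ψ ⟨hφ, h1⟩ ⟨hψ, h2⟩
    refine ⟨hφ.add hψ, fun K hK => ?_⟩
    obtain ⟨A, hA, h1⟩ := h1 K hK
    obtain ⟨B, hB, h2⟩ := h2 K hK
    have hAB : 0 < min A B := lt_min hA hB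
    exact ⟨min A B, hAB, gevreyNorm_add_lt_top hAB hφ hψ
      ((gevreyNorm_anti hAB (min_le_left A B)).trans_lt h1)
      ((gevreyNorm_anti hAB (min_le_right A B)).trans_lt h2)⟩
  smul_mem' := by
    rintro c φ ⟨hφ, h⟩
    refine ⟨contDiff_const.smul hφ, fun K hK => ?_⟩
    obtain ⟨A, hA, h⟩ := h K hK
    exact ⟨A, hA, gevreyNorm_smul_lt_top hφ h c⟩

/-- The space `𝒮^{(s)}(ℝ^d)`: smooth functions for which `‖φ‖_{s,A}` is finite for every
`A > 0`. -/
def BeurlingS (d : ℕ) (s : ℝ) : Set (Eu d → ℂ) :=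
  {φ | ContDiff ℝ ∞ φ ∧ ∀ A : ℝ, 0 < A → gelfandShilovNorm s A φ < ⊤}

theorem BeurlingD_le_RoumieuE (d : ℕ) (s : ℝ) : BeurlingD d s ≤ RoumieuE d s := by
  rintro φ ⟨hφ, K, _, hφK, h⟩
  exact ⟨hφ, fun L _ => ⟨1, one_pos, (gevreyNorm_le_of_tsupport hφK).trans_lt (h 1 one_pos)⟩⟩

/-! ### Ultradistributions -/

/-- `f ∈ (𝒟^{(s)})'(ℝ^d)`: the linear functional `f` is continuous on the inductive limit (over
the compact sets `K`) of the projective limits (over `A → ∞`), i.e. for every compact `K` its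
restriction to the functions supported in `K` is bounded by a multiple of some
`‖·‖_{s,A,K}`. -/
def IsUltradistribution {d : ℕ} {s : ℝ} (f : BeurlingD d s →ₗ[ℂ] ℂ) : Prop :=
  ∀ K : Set (Eu d), IsCompact K → ∃ A : ℝ, 0 < A ∧ ∃ C : NNReal, ∀ φ : BeurlingD d s,
    tsupport (φ : Eu d → ℂ) ⊆ K → ENNReal.ofReal ‖f φ‖ ≤ C * gevreyNorm s A K φ

/-- `f ∈ (ℰ^{{s}})'(ℝ^d)`: the linear functional `f` is continuous on the projective limit (over
the compact sets `K`) of the inductive limits (over `A → 0`), i.e. there is one compact `K` such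
that for every `A > 0` the functional is bounded by a multiple of `‖·‖_{s,A,K}` (a bound that
says nothing about a function with `‖φ‖_{s,A,K} = ∞`). -/
def IsCompactUltradistribution {d : ℕ} {s : ℝ} (f : RoumieuE d s →ₗ[ℂ] ℂ) : Prop :=
  ∃ K : Set (Eu d), IsCompact K ∧ ∀ A : ℝ, 0 < A → ∃ C : NNReal, ∀ φ : RoumieuE d s,
    gevreyNorm s A K φ < ⊤ → ENNReal.ofReal ‖f φ‖ ≤ C * gevreyNorm s A K φ

/-- A functional on `𝒟^{(s)}` belongs to `(ℰ^{{s}})'` if it is the restriction of an element of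
`(ℰ^{{s}})'`. -/
def BelongsToCompactUltradistributions {d : ℕ} {s : ℝ} (f : BeurlingD d s →ₗ[ℂ] ℂ) : Prop :=
  ∃ g : RoumieuE d s →ₗ[ℂ] ℂ, IsCompactUltradistribution g ∧
    ∀ φ : BeurlingD d s, f φ = g ⟨φ, BeurlingD_le_RoumieuE d s φ.2⟩

/-! ### The short-time Fourier transform -/

/-- The function `y ↦ conj (φ (y - x)) * exp(-i⟨ξ, y⟩)`. -/
def stftAtom {d : ℕ} (φ : Eu d → ℂ) (x ξ : Eu d) : Eu d → ℂ :=
  fun y => (starRingEnd ℂ) (φ (y - x)) * character ξ y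

theorem stftAtom_bound {d : ℕ} {s : ℝ} (hs : 1 < s) {φ : Eu d → ℂ} (hφ : ContDiff ℝ ∞ φ)
    (h : ∀ A : ℝ, 0 < A → gevreyNorm s A Set.univ φ < ⊤) (x ξ : Eu d) :
    ContDiff ℝ ∞ (stftAtom φ x ξ) ∧
      ∀ A : ℝ, 0 < A → gevreyNorm s A Set.univ (stftAtom φ x ξ) < ⊤ := by
  have hc : ContDiff ℝ ∞ fun y => (starRingEnd ℂ) (φ (y - x)) :=
    Complex.conjCLE.contDiff.comp (hφ.comp (contDiff_id.sub contDiff_const))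
  refine ⟨hc.mul (contDiff_character ξ), gevreyNorm_of_bound hs
    (bound_mul hs hc (contDiff_character ξ) (fun A hA => ?_) (bound_character hs ξ))⟩
  obtain ⟨C, hC, h⟩ := bound_of_gevreyNorm hs hφ h A hA
  refine ⟨C, hC, fun n y => ?_⟩
  have e : ‖iteratedFDeriv ℝ n (fun y => (starRingEnd ℂ) (φ (y - x))) y‖ =
      ‖iteratedFDeriv ℝ n φ (y - x)‖ := by
    rw [← iteratedFDeriv_comp_sub]
    exact Complex.conjLIE.norm_iteratedFDeriv_comp_left (fun y => φ (y - x)) y n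
  rw [e]
  exact h n (y - x)

theorem stftAtom_mem_BeurlingD {d : ℕ} {s : ℝ} (hs : 1 < s) {φ : Eu d → ℂ}
    (hφ : φ ∈ BeurlingD d s) (x ξ : Eu d) : stftAtom φ x ξ ∈ BeurlingD d s := by
  obtain ⟨hφ, K, hK, hφK, h⟩ := hφ
  obtain ⟨h1, h2⟩ := stftAtom_bound hs hφ
    (fun A hA => (gevreyNorm_le_of_tsupport hφK).trans_lt (h A hA)) x ξ
  have hK' : IsCompact ((fun y => y + x) '' K) := hK.image (by fun_prop)
  refine ⟨h1, _, hK', closure_minimal (fun y hy => ?_) hK'.isClosed,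
    fun A hA => (gevreyNorm_mono_set (Set.subset_univ _)).trans_lt (h2 A hA)⟩
  refine ⟨y - x, hφK (subset_tsupport φ fun h0 => hy ?_), sub_add_cancel y x⟩
  simp [stftAtom, h0]

theorem stftAtom_mem_RoumieuE {d : ℕ} {s : ℝ} (hs : 1 < s) {φ : Eu d → ℂ}
    (hφ : φ ∈ BeurlingS d s) (x ξ : Eu d) : stftAtom φ x ξ ∈ RoumieuE d s := by
  obtain ⟨hφ, h⟩ := hφ
  obtain ⟨h1, h2⟩ := stftAtom_bound hs hφ (fun A hA => by
    refine lt_of_le_of_lt ?_ (h A hA)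
    refine le_trans ?_ (le_iSup (fun α : Fin d → ℕ => ⨆ β : Fin d → ℕ, ⨆ x : Eu d,
      ENNReal.ofReal (A ^ order (α + β) / (mfact α ^ s * mfact β ^ s) *
      √(1 + ‖x‖ ^ 2) ^ order α * ‖partialDeriv β φ x‖)) 0)
    refine iSup_mono fun β => iSup_mono fun x => iSup_le fun _ => le_of_eq ?_
    simp [mfact, order]) x ξ
  exact ⟨h1, fun K _ => ⟨1, one_pos,
    (gevreyNorm_mono_set (Set.subset_univ _)).trans_lt (h2 1 one_pos)⟩⟩

/-- The short-time Fourier transform `V_φ f(x, ξ) = (2π)^{-d/2} ⟨f, conj φ(· - x) e^{-i⟨ξ, ·⟩}⟩`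
of `f ∈ (ℰ^{{s}})'` with window `φ ∈ 𝒮^{(s)}`. -/
def stftE {d : ℕ} {s : ℝ} (hs : 1 < s) (f : RoumieuE d s →ₗ[ℂ] ℂ) (φ : BeurlingS d s)
    (x ξ : Eu d) : ℂ :=
  (((2 * Real.pi) ^ (-(d : ℝ) / 2) : ℝ) : ℂ) *
    f ⟨stftAtom φ x ξ, stftAtom_mem_RoumieuE hs φ.2 x ξ⟩

/-- The short-time Fourier transform `V_φ f(x, ξ) = (2π)^{-d/2} ⟨f, conj φ(· - x) e^{-i⟨ξ, ·⟩}⟩`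
of `f ∈ (𝒟^{(s)})'` with window `φ ∈ 𝒟^{(s)}`. -/
def stftD {d : ℕ} {s : ℝ} (hs : 1 < s) (f : BeurlingD d s →ₗ[ℂ] ℂ) (φ : BeurlingD d s)
    (x ξ : Eu d) : ℂ :=
  (((2 * Real.pi) ^ (-(d : ℝ) / 2) : ℝ) : ℂ) *
    f ⟨stftAtom φ x ξ, stftAtom_mem_BeurlingD hs φ.2 x ξ⟩

end UltraSTFT

end

noncomputable section

namespace UltraSTFT

/-! ### Elementary inequalities -/

/-! Gevrey bounds of order s and radius A trade against exponentials of |ξ|^{1/s}. A character has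
Gevrey constant exp(s(A|ξ|)^{1/s}); conversely, a compactly supported function with Gevrey radius A
has a Fourier transform of size exp(-c A^{1/s}|ξ|^{1/s}). A functional in the Roumieu dual accepts
every A > 0, however small, so on modulated windows it grows no faster than exp(ε|ξ|^{1/s}) for any
ε > 0. Together with the decay of a Gelfand–Shilov window seen from a fixed compact set this gives
the first assertion (`exists_bound_stftE`). In the second assertion the support condition is
necessary because a functional carried by K annihilates functions whose supports miss K.

The converse is an explicit extension. Over a fine lattice of points x_j the sum Θ of the
|φ(·-x_j)|² has no zero, and 1/Θ again satisfies Beurling bounds on compact sets (`BeurlingOn.inv`).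
Hence ψ is the sum of the products conj φ(·-x_j)·χ_j with χ_j = φ(·-x_j)ψ/Θ
(`exists_window_partition`). The Fourier series of χ_j on a cube around x_j turns each product into
a series of atoms, so f(ψ) becomes a double series of coefficients times values of f on atoms
(`IsUltradistribution.hasSum_locCoeff`).

That series still makes sense when ψ is only of Roumieu type: the coefficients then decay like
exp(-δ|ξ|^{1/s}) for some δ > 0, which beats the growth of f on atoms (`exists_localExtension`).
Atoms centred outside K contribute nothing, so finitely many j remain, and their sum is the required
extension (`belongsToCompactUltradistributions_of_atom_bounds`). -/

theorem pow_le_factorial_rpow_mul_exp {s : ℝ} (hs : 0 < s) {t : ℝ} (ht : 0 ≤ t) (n : ℕ) :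
    t ^ n ≤ (n.factorial : ℝ) ^ s * Real.exp (s * t ^ (1 / s)) := by
  -- The case s = 1 at the argument t^{1/s}; raising it to the power s gives the claim.
  have h := Real.pow_div_factorial_le_exp (t ^ (1 / s)) (by positivity) n
  rw [div_le_iff₀ (by positivity)] at h
  have h2 := Real.rpow_le_rpow (by positivity) h hs.le
  rw [Real.mul_rpow (by positivity) (by positivity), ← Real.exp_mul, ← Real.rpow_natCast,
    ← Real.rpow_mul (by positivity), ← Real.rpow_mul ht] at h2
  rw [show 1 / s * ((n : ℝ) * s) = n by field_simp, Real.rpow_natCast] at h2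
  rw [mul_comm, mul_comm s]
  exact h2

/-- After taking 1/s-th powers the hypothesis bounds every term of the exponential series at
t^{1/s}. Halving the argument makes the bound geometric, hence summable; the price is the rate s/2
and the factor 2^s. -/
theorem mul_exp_le_of_forall_pow_mul_le {s : ℝ} (hs : 0 < s) {t v M : ℝ} (ht : 0 ≤ t)
    (hv : 0 ≤ v) (h : ∀ n : ℕ, t ^ n * v ≤ M * (n.factorial : ℝ) ^ s) :
    v * Real.exp (s / 2 * t ^ (1 / s)) ≤ 2 ^ s * M := by
  have hM : 0 ≤ M := hv.trans (by simpa using h 0)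
  set τ := t ^ (1 / s) / 2 with hτ
  have hτ0 : 0 ≤ τ := by positivity
  set r := v ^ (1 / s)
  have hr : 0 ≤ r := by positivity
  set m := M ^ (1 / s)
  have key : ∀ n : ℕ, τ ^ n / n.factorial * r ≤ m * (1 / 2) ^ n := by
    intro n
    have h1 := Real.rpow_le_rpow (by positivity) (h n) (show 0 ≤ 1 / s by positivity)
    rw [Real.mul_rpow (by positivity) hv, Real.mul_rpow hM (by positivity),
      ← Real.rpow_mul (by positivity), mul_one_div_cancel hs.ne', Real.rpow_one,
      ← Real.rpow_natCast, ← Real.rpow_mul ht, mul_comm (n : ℝ), Real.rpow_mul ht,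
      Real.rpow_natCast] at h1
    rw [hτ, div_pow, div_mul_eq_mul_div, div_le_iff₀ (by positivity), div_mul_eq_mul_div,
      div_le_iff₀ (by positivity)]
    calc (t ^ (1 / s)) ^ n * r ≤ m * n.factorial := h1
      _ = m * (1 / 2) ^ n * n.factorial * 2 ^ n := by
        rw [one_div, inv_pow]; field_simp
  have h3 : Real.exp τ * r ≤ m * 2 := by
    have e1 : HasSum (fun n : ℕ => τ ^ n / n.factorial * r) (Real.exp τ * r) := by
      have := NormedSpace.expSeries_div_hasSum_exp (𝔸 := ℝ) τ
      rw [← Real.exp_eq_exp_ℝ] at this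
      exact this.mul_right r
    have e2 : HasSum (fun n : ℕ => m * (1 / 2 : ℝ) ^ n) (m * 2) :=
      hasSum_geometric_two.mul_left m
    exact hasSum_le key e1 e2
  have h4 := Real.rpow_le_rpow (by positivity) h3 hs.le
  rw [Real.mul_rpow (by positivity) hr, Real.mul_rpow (by positivity) (by norm_num),
    ← Real.exp_mul, ← Real.rpow_mul hv, ← Real.rpow_mul hM, one_div_mul_cancel hs.ne',
    Real.rpow_one, Real.rpow_one] at h4
  rw [show s / 2 * t ^ (1 / s) = τ * s by rw [hτ]; ring]
  linarith

theorem rpow_add_le_rpow_add_rpow {s : ℝ} (hs : 1 ≤ s) {a b : ℝ} (ha : 0 ≤ a) (hb : 0 ≤ b) :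
    (a + b) ^ (1 / s) ≤ a ^ (1 / s) + b ^ (1 / s) :=
  Real.rpow_add_le_add_rpow ha hb (by positivity) ((div_le_one (by positivity)).2 hs)

theorem exists_pow_mul_exp_neg_le {s : ℝ} (hs : 1 ≤ s) {ε : ℝ} (hε : 0 < ε) (N : ℕ) :
    ∃ C : ℝ, 0 ≤ C ∧ ∀ t : ℝ, 0 ≤ t → (1 + t) ^ N * Real.exp (-ε * t ^ (1 / s)) ≤ C := by
  have hs0 : 0 < s := by linarith
  -- Scaled so that s(c(1+t))^{1/s} = ε(1+t)^{1/s}.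
  set c := (ε / s) ^ s with hc
  have hc0 : 0 < c := by positivity
  refine ⟨(N.factorial : ℝ) ^ s * Real.exp ε / c ^ N, by positivity, fun t ht => ?_⟩
  have h1 := pow_le_factorial_rpow_mul_exp hs0 (t := c * (1 + t)) (by positivity) N
  rw [Real.mul_rpow hc0.le (by positivity), hc, ← Real.rpow_mul (by positivity),
    mul_one_div_cancel hs0.ne', Real.rpow_one, ← hc, ← mul_assoc, mul_div_cancel₀ _ hs0.ne',
    mul_pow] at h1
  have h2 := rpow_add_le_rpow_add_rpow hs zero_le_one ht
  rw [Real.one_rpow] at h2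
  rw [le_div_iff₀ (by positivity)]
  calc (1 + t) ^ N * Real.exp (-ε * t ^ (1 / s)) * c ^ N
      = (c ^ N * (1 + t) ^ N) * Real.exp (-ε * t ^ (1 / s)) := by ring
    _ ≤ ((N.factorial : ℝ) ^ s * Real.exp (ε * (1 + t ^ (1 / s)))) *
        Real.exp (-ε * t ^ (1 / s)) := by
        refine mul_le_mul_of_nonneg_right (h1.trans ?_) (by positivity)
        gcongr
    _ = _ := by
        rw [mul_assoc, ← Real.exp_add]; ring_nf

/-! ### Summability over the integer lattice -/

theorem summable_pi_prod {d : ℕ} {g : ℤ → ℝ} (hg : ∀ n, 0 ≤ g n) (h : Summable g) :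
    Summable fun k : Fin d → ℤ => ∏ i, g (k i) := by
  classical
  refine summable_of_sum_le (c := (∑' n, g n) ^ d)
    (fun k => Finset.prod_nonneg fun i _ => hg _) fun u => ?_
  set T : Fin d → Finset ℤ := fun i => u.image fun k => k i
  have hsub : u ⊆ Fintype.piFinset T := fun k hk =>
    Fintype.mem_piFinset.2 fun i => Finset.mem_image_of_mem _ hk
  calc ∑ k ∈ u, ∏ i, g (k i) ≤ ∑ k ∈ Fintype.piFinset T, ∏ i, g (k i) :=
        Finset.sum_le_sum_of_subset_of_nonneg hsub fun k _ _ =>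
          Finset.prod_nonneg fun i _ => hg _
    _ = ∏ i, ∑ n ∈ T i, g n := (Finset.prod_univ_sum T fun _ n => g n).symm
    _ ≤ ∏ _i : Fin d, ∑' n, g n := Finset.prod_le_prod
        (fun i _ => Finset.sum_nonneg fun n _ => hg n)
        fun i _ => h.sum_le_tsum _ fun n _ => hg n
    _ = _ := by simp

/-- The integer point `k ∈ ℤ^d`, as a vector of `ℝ^d`. -/
def intVec {d : ℕ} (k : Fin d → ℤ) : Eu d := WithLp.toLp 2 fun i => (k i : ℝ)

@[simp] theorem intVec_apply {d : ℕ} (k : Fin d → ℤ) (i : Fin d) : intVec k i = k i := rfl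

theorem summable_exp_neg_norm_intVec {d : ℕ} {s : ℝ} (hs : 1 ≤ s) {ε : ℝ} (hε : 0 < ε) :
    Summable fun k : Fin d → ℤ => Real.exp (-ε * ‖intVec k‖ ^ (1 / s)) := by
  -- The power 2d supplies a summable factor (1+|k_i|)^{-2} for each of the d coordinates.
  obtain ⟨C, hC, h⟩ := exists_pow_mul_exp_neg_le hs hε (2 * d)
  have h1 : Summable fun n : ℤ => ((1 + |(n : ℝ)|) ^ 2)⁻¹ := by
    refine Summable.of_norm_bounded_eventually
      (Real.summable_one_div_int_pow.2 one_lt_two) ?_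
    refine (Set.finite_singleton (0 : ℤ)).subset fun n hn => ?_
    by_contra h0
    refine hn ?_
    have h2 : (0 : ℝ) < |(n : ℝ)| := abs_pos.2 (by exact_mod_cast h0)
    change ‖((1 + |(n : ℝ)|) ^ 2)⁻¹‖ ≤ 1 / (n : ℝ) ^ 2
    rw [Real.norm_of_nonneg (by positivity), ← sq_abs (n : ℝ), one_div]
    gcongr
    linarith
  refine Summable.of_nonneg_of_le (fun k => by positivity) (fun k => ?_)
    ((summable_pi_prod (d := d) (fun n => by positivity) h1).mul_left C)
  have h2 := h ‖intVec k‖ (norm_nonneg _)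
  have h3 : ∏ i, (1 + |(k i : ℝ)|) ^ 2 ≤ (1 + ‖intVec k‖) ^ (2 * d) := by
    rw [pow_mul]
    calc ∏ i, (1 + |(k i : ℝ)|) ^ 2 ≤ ∏ _i : Fin d, (1 + ‖intVec k‖) ^ 2 := by
          refine Finset.prod_le_prod (fun i _ => by positivity) fun i _ => ?_
          have := PiLp.norm_apply_le (intVec k) i
          rw [intVec_apply, Real.norm_eq_abs] at this
          gcongr
      _ = _ := by simp
  have h4 : 0 < ∏ i, (1 + |(k i : ℝ)|) ^ 2 := Finset.prod_pos fun i _ => by positivity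
  rw [Finset.prod_inv_distrib, ← div_eq_mul_inv, le_div_iff₀ h4]
  refine le_trans ?_ h2
  rw [mul_comm]
  gcongr

/-! ### Pointwise Gevrey bounds -/

variable {d : ℕ}

/-- The derivatives of `φ` at `y` satisfy the Gevrey bounds of order `s` with radius `A` and
constant `C`. -/
def GevreyAt (s A C : ℝ) (φ : Eu d → ℂ) (y : Eu d) : Prop :=
  ∀ n : ℕ, A ^ n * ‖iteratedFDeriv ℝ n φ y‖ ≤ C * (n.factorial : ℝ) ^ s

namespace GevreyAt

variable {s A B C C' : ℝ} {φ ψ : Eu d → ℂ} {x y : Eu d}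

theorem norm_le (h : GevreyAt s A C φ y) : ‖φ y‖ ≤ C := by
  simpa using h 0

theorem nonneg (h : GevreyAt s A C φ y) : 0 ≤ C := (norm_nonneg _).trans h.norm_le

theorem mono (h : GevreyAt s A C φ y) (hC : C ≤ C') : GevreyAt s A C' φ y :=
  fun n => (h n).trans (by gcongr)

theorem anti (h : GevreyAt s B C φ y) (hA : 0 ≤ A) (hAB : A ≤ B) : GevreyAt s A C φ y :=
  fun n => le_trans (by gcongr) (h n)

theorem congr (h : GevreyAt s A C φ y) (e : φ =ᶠ[nhds y] ψ) : GevreyAt s A C ψ y := fun n => by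
  rw [← (e.iteratedFDeriv ℝ n).eq_of_nhds]
  exact h n

theorem of_eventuallyEq_zero (e : φ =ᶠ[nhds y] 0) : GevreyAt s A 0 φ y := fun n => by
  rw [(e.iteratedFDeriv ℝ n).eq_of_nhds]
  simp

theorem of_notMem_tsupport (hy : y ∉ tsupport φ) : GevreyAt s A 0 φ y :=
  of_eventuallyEq_zero (notMem_tsupport_iff_eventuallyEq.1 hy)

theorem sum {ι : Type*} {S : Finset ι} {F : ι → Eu d → ℂ} {c : ι → ℝ} (hA : 0 ≤ A)
    (hF : ∀ i ∈ S, ContDiff ℝ ∞ (F i)) (h : ∀ i ∈ S, GevreyAt s A (c i) (F i) y) :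
    GevreyAt s A (∑ i ∈ S, c i) (fun z => ∑ i ∈ S, F i z) y := fun n => by
  have e : (fun z => ∑ i ∈ S, F i z) = ∑ i ∈ S, F i := by ext z; simp
  rw [e, iteratedFDeriv_sum_apply
    fun i hi => ((hF i hi).of_le (by exact_mod_cast le_top)).contDiffAt]
  calc _ ≤ A ^ n * ∑ i ∈ S, ‖iteratedFDeriv ℝ n (F i) y‖ := by gcongr; exact norm_sum_le _ _
    _ = ∑ i ∈ S, A ^ n * ‖iteratedFDeriv ℝ n (F i) y‖ := Finset.mul_sum _ _ _
    _ ≤ ∑ i ∈ S, c i * (n.factorial : ℝ) ^ s := Finset.sum_le_sum fun i hi => h i hi n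
    _ = _ := (Finset.sum_mul _ _ _).symm

/-- Since i!(n-i)! ≤ n!, the only loss in Leibniz's rule is the sum 2^n of the binomial
coefficients, absorbed by halving the radius. -/
theorem mul (hs : 0 ≤ s) (hA : 0 ≤ A) (hφ : ContDiff ℝ ∞ φ) (hψ : ContDiff ℝ ∞ ψ)
    (h1 : GevreyAt s A C φ y) (h2 : GevreyAt s A C' ψ y) :
    GevreyAt s (A / 2) (C * C') (fun z => φ z * ψ z) y := by
  intro n
  have hC := h1.nonneg
  have hC' := h2.nonneg
  have h3 := norm_iteratedFDeriv_mul_le hφ hψ y (n := n) (by exact_mod_cast le_top)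
  rw [div_pow, div_mul_eq_mul_div, div_le_iff₀ (by positivity)]
  calc A ^ n * ‖iteratedFDeriv ℝ n (fun y => φ y * ψ y) y‖
      ≤ A ^ n * ∑ i ∈ Finset.range (n + 1), (n.choose i : ℝ) *
        ‖iteratedFDeriv ℝ i φ y‖ * ‖iteratedFDeriv ℝ (n - i) ψ y‖ := by gcongr
    _ = ∑ i ∈ Finset.range (n + 1), (n.choose i : ℝ) *
        ((A ^ i * ‖iteratedFDeriv ℝ i φ y‖) *
          (A ^ (n - i) * ‖iteratedFDeriv ℝ (n - i) ψ y‖)) := by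
        rw [Finset.mul_sum]
        refine Finset.sum_congr rfl fun i hi => ?_
        have hi' : i ≤ n := Nat.lt_succ_iff.1 (Finset.mem_range.1 hi)
        rw [← Nat.add_sub_cancel' hi', pow_add]
        simp only [Nat.add_sub_cancel_left]
        ring
    _ ≤ ∑ i ∈ Finset.range (n + 1), (n.choose i : ℝ) *
        (C * C' * (n.factorial : ℝ) ^ s) := by
        refine Finset.sum_le_sum fun i hi => ?_
        have hi' : i ≤ n := Nat.lt_succ_iff.1 (Finset.mem_range.1 hi)
        refine mul_le_mul_of_nonneg_left ?_ (by positivity)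
        calc _ ≤ (C * (i.factorial : ℝ) ^ s) * (C' * ((n - i).factorial : ℝ) ^ s) :=
              mul_le_mul (h1 i) (h2 (n - i)) (by positivity) (by positivity)
          _ = C * C' * ((i.factorial : ℝ) * ((n - i).factorial : ℝ)) ^ s := by
              rw [Real.mul_rpow (by positivity) (by positivity)]; ring
          _ ≤ C * C' * (n.factorial : ℝ) ^ s := by
              have : (i.factorial : ℝ) * ((n - i).factorial : ℝ) ≤ (n.factorial : ℝ) := by
                exact_mod_cast Nat.le_of_dvd (Nat.factorial_pos _)
                  (Nat.factorial_mul_factorial_dvd_factorial hi')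
              gcongr
    _ = C * C' * (n.factorial : ℝ) ^ s * 2 ^ n := by
        rw [← Finset.sum_mul, mul_comm]
        congr 1
        exact_mod_cast Nat.sum_range_choose n

theorem conj_comp_sub (h : GevreyAt s A C φ (y - x)) :
    GevreyAt s A C (fun z => (starRingEnd ℂ) (φ (z - x))) y := fun n => by
  have e : ‖iteratedFDeriv ℝ n (fun y => (starRingEnd ℂ) (φ (y - x))) y‖ =
      ‖iteratedFDeriv ℝ n φ (y - x)‖ := by
    rw [← iteratedFDeriv_comp_sub]
    exact Complex.conjLIE.norm_iteratedFDeriv_comp_left (fun y => φ (y - x)) y n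
  rw [e]
  exact h n

theorem comp_sub (h : GevreyAt s A C φ (y - x)) :
    GevreyAt s A C (fun z => φ (z - x)) y := fun n => by
  rw [iteratedFDeriv_comp_sub]
  exact h n

theorem comp_add_smul (hφ : ContDiff ℝ ∞ φ) {T : ℝ} (hT : 0 < T) (hA : 0 ≤ A)
    (h : GevreyAt s A C φ (x + T • y)) :
    GevreyAt s (A / T) C (fun z => φ (x + T • z)) y := fun n => by
  let L : Eu d →L[ℝ] Eu d := T • ContinuousLinearMap.id ℝ (Eu d)
  have e : iteratedFDeriv ℝ n (fun z => φ (x + T • z)) y =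
      (iteratedFDeriv ℝ n (fun z => φ (x + z)) (L y)).compContinuousLinearMap fun _ => L :=
    L.iteratedFDeriv_comp_right (f := fun z => φ (x + z))
      (hφ.comp (contDiff_const.add contDiff_id)) y (i := n) (by exact_mod_cast le_top)
  have hL : ‖L‖ ≤ T := by
    refine ContinuousLinearMap.opNorm_le_bound _ hT.le fun z => ?_
    simp [L, norm_smul, abs_of_pos hT]
  have h1 : ‖iteratedFDeriv ℝ n (fun z => φ (x + T • z)) y‖ ≤
      ‖iteratedFDeriv ℝ n φ (x + T • y)‖ * T ^ n := by
    rw [e, iteratedFDeriv_comp_add_left]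
    refine (ContinuousMultilinearMap.norm_compContinuousLinearMap_le _ _).trans ?_
    rw [Finset.prod_const, Finset.card_univ, Fintype.card_fin]
    gcongr
    exact le_rfl
  calc _ ≤ (A / T) ^ n * (‖iteratedFDeriv ℝ n φ (x + T • y)‖ * T ^ n) := by gcongr
    _ = A ^ n * ‖iteratedFDeriv ℝ n φ (x + T • y)‖ := by rw [div_pow]; field_simp
    _ ≤ _ := h n

theorem character (hs : 0 < s) (hA : 0 ≤ A) (ξ y : Eu d) :
    GevreyAt s A (Real.exp (s * (A * ‖ξ‖) ^ (1 / s))) (character ξ) y := fun n => by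
  calc _ ≤ A ^ n * ‖ξ‖ ^ n := by gcongr; exact norm_iteratedFDeriv_character_le ξ n y
    _ = (A * ‖ξ‖) ^ n := (mul_pow _ _ _).symm
    _ ≤ _ := pow_le_factorial_rpow_mul_exp hs (by positivity) n
    _ = _ := mul_comm _ _

/-- The operator norm costs d^n against partial derivatives, while β! ≤ n!. Dividing by d + 1
instead of d covers d = 0. -/
theorem of_partialDeriv (hs : 0 ≤ s) (hA : 0 < A) (hφ : ContDiff ℝ ∞ φ)  (hC : 0 ≤ C)
    (h : ∀ β : Fin d → ℕ, A ^ order β / mfact β ^ s * ‖partialDeriv β φ y‖ ≤ C) :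
    GevreyAt s (A / (d + 1)) C φ y := fun n => by
  have h1 := norm_iteratedFDeriv_le hφ n y (M := C * (n.factorial : ℝ) ^ s / A ^ n)
    (by positivity) (by
      intro β hβ
      have h2 := h β
      have hm := mfact_pos β
      have h3 : mfact β ^ s ≤ (n.factorial : ℝ) ^ s := by
        rw [← hβ]
        exact Real.rpow_le_rpow hm.le (mfact_le β) hs
      rw [hβ, div_mul_eq_mul_div, div_le_iff₀ (by positivity)] at h2
      rw [le_div_iff₀ (by positivity), mul_comm]
      exact h2.trans (mul_le_mul_of_nonneg_left h3 hC))
  calc (A / (d + 1)) ^ n * ‖iteratedFDeriv ℝ n φ y‖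
      ≤ (A / (d + 1)) ^ n * ((d : ℝ) ^ n * (C * (n.factorial : ℝ) ^ s / A ^ n)) := by gcongr
    _ = ((d : ℝ) / (d + 1)) ^ n * (C * (n.factorial : ℝ) ^ s) := by
        rw [div_pow, div_pow]; field_simp
    _ ≤ 1 * (C * (n.factorial : ℝ) ^ s) := by
        gcongr
        exact pow_le_one₀ (by positivity) (by rw [div_le_one (by positivity)]; linarith)
    _ = _ := one_mul _

/-- The opposite passage loses through n! ≤ d^n β!. Such losses of radius are harmless, since the
continuity conditions quantify over A. -/
theorem partialDeriv_le (hs : 0 ≤ s) (hA : 0 ≤ A) (h : GevreyAt s A C φ y) (β : Fin d → ℕ) :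
    (A / ((d : ℝ) ^ s + 1)) ^ order β / mfact β ^ s * ‖partialDeriv β φ y‖ ≤ C := by
  have hd : (0 : ℝ) ≤ (d : ℝ) ^ s := by positivity
  have hm := mfact_pos β
  have hC := h.nonneg
  set n := order β with hn
  have h3 : (n.factorial : ℝ) ^ s ≤ ((d : ℝ) ^ s + 1) ^ n * mfact β ^ s := by
    have h4 := Real.rpow_le_rpow (by positivity) (factorial_le_mfact β) hs
    rw [Real.mul_rpow (by positivity) hm.le, ← Real.rpow_natCast, ← Real.rpow_mul (by positivity),
      mul_comm ((order β : ℕ) : ℝ) s, Real.rpow_mul (by positivity), Real.rpow_natCast] at h4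
    refine h4.trans ?_
    gcongr
    linarith
  rw [div_pow, div_div, div_mul_eq_mul_div, div_le_iff₀ (by positivity)]
  calc A ^ n * ‖partialDeriv β φ y‖ ≤ A ^ n * ‖iteratedFDeriv ℝ n φ y‖ := by
        gcongr; exact norm_partialDeriv_le β φ y
    _ ≤ _ := h n
    _ ≤ _ := by gcongr

end GevreyAt

theorem gevreyNorm_le_ofReal {s A C : ℝ} {φ : Eu d → ℂ} {K : Set (Eu d)} (hs : 0 ≤ s)
    (hA : 0 ≤ A) (h : ∀ y ∈ K, GevreyAt s A C φ y) :
    gevreyNorm s (A / ((d : ℝ) ^ s + 1)) K φ ≤ ENNReal.ofReal C :=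
  iSup_le fun β => iSup₂_le fun y hy => ENNReal.ofReal_le_ofReal ((h y hy).partialDeriv_le hs hA β)

theorem gevreyAt_of_gevreyNorm {s A : ℝ} {φ : Eu d → ℂ} {K : Set (Eu d)} (hs : 0 ≤ s)
    (hA : 0 < A) (hφ : ContDiff ℝ ∞ φ) (h : gevreyNorm s A K φ < ⊤) {y : Eu d} (hy : y ∈ K) :
    GevreyAt s (A / (d + 1)) (gevreyNorm s A K φ).toReal φ y := by
  refine .of_partialDeriv hs hA hφ ENNReal.toReal_nonneg fun β => ?_
  refine (ENNReal.ofReal_le_iff_le_toReal h.ne).1 ?_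
  exact (le_iSup₂ (f := fun x (_ : x ∈ K) =>
      ENNReal.ofReal (A ^ order β / mfact β ^ s * ‖partialDeriv β φ x‖)) y hy).trans
      (le_iSup (fun β : Fin d → ℕ => ⨆ x ∈ K,
        ENNReal.ofReal (A ^ order β / mfact β ^ s * ‖partialDeriv β φ x‖)) β)

/-- The function `φ` satisfies Gevrey bounds of Beurling type of order `s`, uniformly on `K`. -/
def BeurlingOn (s : ℝ) (K : Set (Eu d)) (φ : Eu d → ℂ) : Prop :=
  ∀ A : ℝ, 0 < A → ∃ C : ℝ, 0 ≤ C ∧ ∀ y ∈ K, GevreyAt s A C φ y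

/-! ### Reciprocals of functions with Beurling bounds -/

/-- Leibniz's rule for (Θ - Θ(y))Θ⁻¹ = 1 - Θ(y)Θ⁻¹. The first factor vanishes at y, which removes
the term with all n derivatives on Θ⁻¹ and leaves a recursion in lower orders. -/
theorem norm_iteratedFDeriv_inv_le {Θ : Eu d → ℂ} (hΘ : ContDiff ℝ ∞ Θ) (h0 : ∀ z, Θ z ≠ 0)
    (y : Eu d) {n : ℕ} (hn : n ≠ 0) :
    ‖Θ y‖ * ‖iteratedFDeriv ℝ n (fun z => (Θ z)⁻¹) y‖ ≤
      ∑ i ∈ Finset.range n, (n.choose (i + 1) : ℝ) * ‖iteratedFDeriv ℝ (i + 1) Θ y‖ *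
        ‖iteratedFDeriv ℝ (n - (i + 1)) (fun z => (Θ z)⁻¹) y‖ := by
  have hu : ContDiff ℝ ∞ fun z => (Θ z)⁻¹ := hΘ.inv h0
  have hf : ContDiff ℝ ∞ fun z => Θ z - Θ y := hΘ.sub contDiff_const
  have htop : ∀ m : ℕ, ((m : ℕ) : WithTop ℕ∞) ≤ ∞ := fun m => by exact_mod_cast le_top
  have h1 := norm_iteratedFDeriv_mul_le hf hu y (n := n) (htop n)
  have e1 : (fun z => (Θ z - Θ y) * (Θ z)⁻¹) =
      (fun _ => (1 : ℂ)) + fun z => (-Θ y) • (Θ z)⁻¹ := by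
    funext z
    simp only [Pi.add_apply, smul_eq_mul]
    rw [sub_mul, mul_inv_cancel₀ (h0 z)]
    ring
  have e2 : iteratedFDeriv ℝ n (fun z => (Θ z - Θ y) * (Θ z)⁻¹) y =
      (-Θ y) • iteratedFDeriv ℝ n (fun z => (Θ z)⁻¹) y := by
    have hu' : ContDiff ℝ n fun z => (-Θ y) • (Θ z)⁻¹ :=
      (hu.const_smul (-Θ y)).of_le (htop n)
    rw [e1, iteratedFDeriv_add_apply contDiff_const.contDiffAt hu'.contDiffAt,
      iteratedFDeriv_const_of_ne hn]
    simp only [Pi.zero_apply, zero_add]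
    exact iteratedFDeriv_const_smul_apply (a := -Θ y) (f := fun z => (Θ z)⁻¹)
      (hu.of_le (htop n)).contDiffAt
  rw [e2, norm_smul, norm_neg, Finset.sum_range_succ'] at h1
  refine h1.trans (le_of_eq ?_)
  simp only [norm_iteratedFDeriv_zero, sub_self, norm_zero, mul_zero, zero_mul, add_zero]
  refine Finset.sum_congr rfl fun i _ => ?_
  have e3 : iteratedFDeriv ℝ (i + 1) (fun z => Θ z - Θ y) y = iteratedFDeriv ℝ (i + 1) Θ y := by
    have : (fun z => Θ z - Θ y) = Θ + fun _ => -Θ y := by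
      funext z; simp [sub_eq_add_neg]
    rw [this, iteratedFDeriv_add_apply (hΘ.of_le (htop _)).contDiffAt contDiff_const.contDiffAt,
      iteratedFDeriv_const_of_ne (Nat.succ_ne_zero i)]
    simp
  rw [e3]

theorem le_choose_of_lt {n k : ℕ} (hk : 1 ≤ k) (hkn : k < n) : n ≤ n.choose k := by
  induction n with
  | zero => omega
  | succ n ih =>
    obtain ⟨k, rfl⟩ := Nat.exists_eq_succ_of_ne_zero (Nat.one_le_iff_ne_zero.1 hk)
    rcases (Nat.lt_succ_iff.1 hkn).lt_or_eq with h | h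
    · have h1 := ih h
      have h2 := Nat.choose_pos (show k ≤ n by omega)
      rw [Nat.choose_succ_succ]
      omega
    · rw [h, Nat.choose_succ_self_right]

/-- The left side is binom(n,k)^{1-s} n!^s. For 1 ≤ k < n the binomial is at least n, giving a gain
n^{1-s} that tends to 0 as s > 1. For k = n there is no gain; then 2^k(1/2)^n = 1 covers the term.
-/
theorem choose_mul_factorial_rpow_le {s : ℝ} (hs : 1 < s) {n k : ℕ} (hk : 1 ≤ k) (hkn : k ≤ n) :
    (n.choose k : ℝ) * (k.factorial : ℝ) ^ s * ((n - k).factorial : ℝ) ^ s ≤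
      (2 : ℝ) ^ k * ((n : ℝ) ^ (1 - s) + (1 / 2) ^ n) * (n.factorial : ℝ) ^ s := by
  have hc : (0 : ℝ) < n.choose k := by exact_mod_cast Nat.choose_pos hkn
  have e : (n.choose k : ℝ) * k.factorial * (n - k).factorial = n.factorial := by
    exact_mod_cast Nat.choose_mul_factorial_mul_factorial hkn
  have e1 : (n.choose k : ℝ) * (k.factorial : ℝ) ^ s * ((n - k).factorial : ℝ) ^ s =
      (n.choose k : ℝ) ^ (1 - s) * (n.factorial : ℝ) ^ s := by
    rw [← e, Real.mul_rpow (by positivity) (by positivity),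
      Real.mul_rpow (by positivity) (by positivity), ← mul_assoc, ← mul_assoc,
      ← Real.rpow_add hc, sub_add_cancel, Real.rpow_one]
  rw [e1]
  refine mul_le_mul_of_nonneg_right ?_ (by positivity)
  have hn0 : (0 : ℝ) < n := by exact_mod_cast hk.trans hkn
  rcases hkn.lt_or_eq with hlt | rfl
  · have h1 : n ≤ n.choose k := le_choose_of_lt hk hlt
    calc (n.choose k : ℝ) ^ (1 - s) ≤ (n : ℝ) ^ (1 - s) :=
          Real.rpow_le_rpow_of_nonpos hn0 (by exact_mod_cast h1) (by linarith)
      _ ≤ 1 * ((n : ℝ) ^ (1 - s) + (1 / 2) ^ n) := by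
          rw [one_mul]; exact le_add_of_nonneg_right (by positivity)
      _ ≤ _ := by
          gcongr
          exact one_le_pow₀ (by norm_num)
  · rw [Nat.choose_self, Nat.cast_one, Real.one_rpow, mul_add, ← mul_pow]
    norm_num
    positivity

/-- In the recursion for the derivatives of Θ⁻¹, order n costs the factor (C/c)δ_n, which tends to
0. The constant therefore grows only over finitely many orders, and the prescribed radius A is kept.
-/
theorem BeurlingOn.inv {s : ℝ} (hs : 1 < s) {K : Set (Eu d)} {Θ : Eu d → ℂ}
    (hΘ : ContDiff ℝ ∞ Θ) (h0 : ∀ z, Θ z ≠ 0) {c : ℝ} (hc : 0 < c) (hcK : ∀ y ∈ K, c ≤ ‖Θ y‖)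
    (h : BeurlingOn s K Θ) : BeurlingOn s K fun z => (Θ z)⁻¹ := by
  intro A hA
  -- Radius 4A yields 4^{-k} on the k-th derivative of Θ: one 2^{-k} cancels the 2^k of
  -- `choose_mul_factorial_rpow_le`, the other makes the sum over k ≥ 1 at most 1.
  obtain ⟨C, hC, h⟩ := h (4 * A) (by positivity)
  set δ : ℕ → ℝ := fun n => (n : ℝ) ^ (1 - s) + (1 / 2) ^ n with hδ
  have hδ0 : ∀ n, 0 ≤ δ n := fun n => by positivity
  have hlim : Filter.Tendsto (fun n => C / c * δ n) Filter.atTop (nhds (C / c * (0 + 0))) := by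
    refine (Filter.Tendsto.add ?_ ?_).const_mul _
    · have := (tendsto_rpow_neg_atTop (y := s - 1) (by linarith)).comp
        tendsto_natCast_atTop_atTop
      simpa [Function.comp_def] using this
    · exact tendsto_pow_atTop_nhds_zero_of_lt_one (by norm_num) (by norm_num)
  obtain ⟨N, hN⟩ := Filter.eventually_atTop.1
    (hlim.eventually_le_const (u := 1) (by simp))
  -- P dominates (C/c)δ_n for n ≥ 1, where δ_n ≤ 2. Orders up to N cost at most P each and later
  -- ones nothing, hence the exponent `min n N` below.
  set P := 1 + C / c * 2 with hP
  have hP1 : 1 ≤ P := by rw [hP]; exact le_add_of_nonneg_right (by positivity)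
  refine ⟨P ^ N / c, by positivity, fun y hy => ?_⟩
  have hcy := hcK y hy
  have main : ∀ n : ℕ, A ^ n * ‖iteratedFDeriv ℝ n (fun z => (Θ z)⁻¹) y‖ ≤
      P ^ min n N / c * (n.factorial : ℝ) ^ s := by
    intro n
    induction n using Nat.strong_induction_on with
    | _ n ih =>
    rcases Nat.eq_zero_or_pos n with rfl | hn
    · simp only [pow_zero, norm_iteratedFDeriv_zero, one_mul, norm_inv, Nat.zero_min,
        Nat.factorial_zero, Nat.cast_one, Real.one_rpow, mul_one, one_div]
      gcongr
    set Q := P ^ min (n - 1) N / c with hQ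
    have hQ0 : 0 ≤ Q := by positivity
    have h1 := norm_iteratedFDeriv_inv_le hΘ h0 y hn.ne'
    have h2 : c * (A ^ n * ‖iteratedFDeriv ℝ n (fun z => (Θ z)⁻¹) y‖) ≤
        C * Q * δ n * (n.factorial : ℝ) ^ s := by
      calc c * (A ^ n * ‖iteratedFDeriv ℝ n (fun z => (Θ z)⁻¹) y‖)
          ≤ ‖Θ y‖ * (A ^ n * ‖iteratedFDeriv ℝ n (fun z => (Θ z)⁻¹) y‖) := by gcongr
        _ = A ^ n * (‖Θ y‖ * ‖iteratedFDeriv ℝ n (fun z => (Θ z)⁻¹) y‖) := by ring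
        _ ≤ A ^ n * _ := mul_le_mul_of_nonneg_left h1 (by positivity)
        _ = ∑ i ∈ Finset.range n, (n.choose (i + 1) : ℝ) *
            (A ^ (i + 1) * ‖iteratedFDeriv ℝ (i + 1) Θ y‖) *
            (A ^ (n - (i + 1)) *
              ‖iteratedFDeriv ℝ (n - (i + 1)) (fun z => (Θ z)⁻¹) y‖) := by
            rw [Finset.mul_sum]
            refine Finset.sum_congr rfl fun i hi => ?_
            have : A ^ n = A ^ (i + 1) * A ^ (n - (i + 1)) := by
              rw [← pow_add, Nat.add_sub_cancel' (Finset.mem_range.1 hi)]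
            rw [this]
            ring
        _ ≤ ∑ i ∈ Finset.range n, C * Q * δ n * (n.factorial : ℝ) ^ s * (1 / 2 * (1 / 2) ^ i) := by
            refine Finset.sum_le_sum fun i hi => ?_
            have hi' := Finset.mem_range.1 hi
            have g1 : A ^ (i + 1) * ‖iteratedFDeriv ℝ (i + 1) Θ y‖ ≤
                C * ((i + 1).factorial : ℝ) ^ s / 4 ^ (i + 1) := by
              rw [le_div_iff₀ (by positivity)]
              have := h y hy (i + 1)
              rw [mul_pow] at this
              linarith
            have g2 : A ^ (n - (i + 1)) *
                ‖iteratedFDeriv ℝ (n - (i + 1)) (fun z => (Θ z)⁻¹) y‖ ≤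
                Q * ((n - (i + 1)).factorial : ℝ) ^ s := by
              refine (ih _ (by omega)).trans ?_
              have hle : min (n - (i + 1)) N ≤ min (n - 1) N := by omega
              rw [hQ]
              gcongr
            have g3 := choose_mul_factorial_rpow_le hs (n := n) (k := i + 1) (by omega) hi'
            calc _ ≤ (n.choose (i + 1) : ℝ) * (C * ((i + 1).factorial : ℝ) ^ s / 4 ^ (i + 1)) *
                  (Q * ((n - (i + 1)).factorial : ℝ) ^ s) := by gcongr
              _ = C * Q / 4 ^ (i + 1) * ((n.choose (i + 1) : ℝ) * ((i + 1).factorial : ℝ) ^ s *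
                  ((n - (i + 1)).factorial : ℝ) ^ s) := by ring
              _ ≤ C * Q / 4 ^ (i + 1) * ((2 : ℝ) ^ (i + 1) * δ n * (n.factorial : ℝ) ^ s) := by
                  gcongr
              _ = _ := by
                  have : (4 : ℝ) ^ (i + 1) = 2 ^ (i + 1) * 2 ^ (i + 1) := by
                    rw [← mul_pow]; norm_num
                  rw [this, ← pow_succ', one_div, inv_pow]
                  field_simp
        _ ≤ C * Q * δ n * (n.factorial : ℝ) ^ s * 1 := by
            rw [← Finset.mul_sum]
            have := hδ0 n
            refine mul_le_mul_of_nonneg_left ?_ (by positivity)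
            rw [← Finset.mul_sum]
            have := (summable_geometric_two).sum_le_tsum (Finset.range n)
              (fun i _ => by positivity)
            rw [tsum_geometric_two] at this
            linarith
        _ = _ := mul_one _
    have h3 : A ^ n * ‖iteratedFDeriv ℝ n (fun z => (Θ z)⁻¹) y‖ ≤
        C / c * δ n * Q * (n.factorial : ℝ) ^ s := by
      rw [mul_comm c, ← le_div_iff₀ hc] at h2
      refine h2.trans (le_of_eq ?_)
      ring
    refine h3.trans (mul_le_mul_of_nonneg_right ?_ (by positivity))
    rcases le_or_gt n N with hnN | hnN
    · have hle : C / c * δ n ≤ P := by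
        have hd2 : δ n ≤ 2 := by
          have a1 : (n : ℝ) ^ (1 - s) ≤ 1 :=
            Real.rpow_le_one_of_one_le_of_nonpos (by exact_mod_cast hn) (by linarith)
          have a2 : (1 / 2 : ℝ) ^ n ≤ 1 := pow_le_one₀ (by norm_num) (by norm_num)
          simp only [hδ]
          linarith
        rw [hP]
        calc C / c * δ n ≤ C / c * 2 := by gcongr
          _ ≤ _ := by linarith
      calc C / c * δ n * Q ≤ P * Q := by gcongr
        _ = P ^ min n N / c := by
          rw [hQ, min_eq_left hnN, min_eq_left (by omega), ← mul_div_assoc, ← pow_succ',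
            Nat.sub_add_cancel hn]
    · have e : Q = P ^ min n N / c := by
        rw [hQ, min_eq_right hnN.le, min_eq_right (by omega)]
      rw [← e]
      exact mul_le_of_le_one_left hQ0 (hN n hnN.le)
  exact fun n => (main n).trans (by
    have := min_le_right n N
    gcongr)

open MeasureTheory
open scoped FourierTransform

/-! ### Fourier transforms of Gevrey functions -/

/-- Evaluating the transform of the n-th derivative on (w,…,w) gives (2π)^n‖w‖^{2n} times the
transform of χ; its operator norm bounds this by the integral times ‖w‖^n, which cancels. -/
theorem pow_mul_norm_fourier_le {χ : Eu d → ℂ} (hχ : ContDiff ℝ ∞ χ) (hc : HasCompactSupport χ)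
    (n : ℕ) (w : Eu d) :
    (2 * Real.pi * ‖w‖) ^ n * ‖𝓕 χ w‖ ≤ ∫ v, ‖iteratedFDeriv ℝ n χ v‖ := by
  have hint : ∀ n : ℕ, (n : ℕ∞) ≤ ⊤ → Integrable (iteratedFDeriv ℝ n χ) := fun n _ =>
    (hχ.continuous_iteratedFDeriv (m := n) (by exact_mod_cast le_top)).integrable_of_hasCompactSupport
      (hc.iteratedFDeriv n)
  have h1 := congrFun (Real.fourier_iteratedFDeriv (N := ⊤) hχ hint (n := n) le_top) w
  have h2 : ‖𝓕 (iteratedFDeriv ℝ n χ) w‖ ≤ ∫ v, ‖iteratedFDeriv ℝ n χ v‖ :=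
    VectorFourier.norm_fourierIntegral_le_integral_norm _ _ _ _ _
  have h3 := (𝓕 (iteratedFDeriv ℝ n χ) w).le_opNorm fun _ => w
  rw [h1, VectorFourier.fourierPowSMulRight_apply, ← h1] at h3
  have e : ‖(-(2 * (Real.pi : ℂ) * Complex.I)) ^ n •
      (∏ _i : Fin n, ((-innerSL ℝ) w) w) • 𝓕 χ w‖ =
      (2 * Real.pi * ‖w‖) ^ n * ‖𝓕 χ w‖ * ‖w‖ ^ n := by
    simp [abs_of_pos Real.pi_pos, mul_pow]
    ring
  rw [e, Finset.prod_const, Finset.card_univ, Fintype.card_fin] at h3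
  have h4 : (2 * Real.pi * ‖w‖) ^ n * ‖𝓕 χ w‖ * ‖w‖ ^ n ≤
      (∫ v, ‖iteratedFDeriv ℝ n χ v‖) * ‖w‖ ^ n :=
    h3.trans (mul_le_mul_of_nonneg_right h2 (by positivity))
  rcases (pow_nonneg (norm_nonneg w) n).lt_or_eq with h | h
  · exact le_of_mul_le_mul_right h4 h
  · rw [mul_pow, ← h, mul_zero, zero_mul]
    exact integral_nonneg fun _ => norm_nonneg _

/-- Integrating the Gevrey bounds over the ball controls all moments (2πA‖w‖)^n of the transform at
once, and `mul_exp_le_of_forall_pow_mul_le` sums them. -/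
theorem norm_fourier_mul_exp_le {s A M : ℝ} (hs : 0 < s) (hA : 0 < A) {χ : Eu d → ℂ}
    (hχ : ContDiff ℝ ∞ χ) {R : ℝ} (hsupp : tsupport χ ⊆ Metric.closedBall 0 R)
    (h : ∀ y, GevreyAt s A M χ y) (w : Eu d) :
    ‖𝓕 χ w‖ * Real.exp (s / 2 * (2 * Real.pi * A * ‖w‖) ^ (1 / s)) ≤
      2 ^ s * (volume.real (Metric.closedBall (0 : Eu d) R) * M) := by
  have hc : HasCompactSupport χ := (isCompact_closedBall _ _).of_isClosed_subset
    (isClosed_tsupport χ) hsupp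
  refine mul_exp_le_of_forall_pow_mul_le hs (by positivity) (norm_nonneg _) fun n => ?_
  have h1 := pow_mul_norm_fourier_le hχ hc n w
  have hM := (h 0).nonneg
  have h2 : ∫ v, ‖iteratedFDeriv ℝ n χ v‖ ≤
      M * (n.factorial : ℝ) ^ s / A ^ n * volume.real (Metric.closedBall (0 : Eu d) R) := by
    rw [← setIntegral_eq_integral_of_forall_compl_eq_zero (s := Metric.closedBall (0 : Eu d) R)]
    · refine (Real.le_norm_self _).trans (norm_setIntegral_le_of_norm_le_const
        measure_closedBall_lt_top fun v _ => ?_)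
      rw [norm_norm, le_div_iff₀ (by positivity), mul_comm]
      exact h v n
    · intro v hv
      rw [norm_eq_zero]
      by_contra h0
      exact hv (hsupp (support_iteratedFDeriv_subset (𝕜 := ℝ) n h0))
  calc (2 * Real.pi * A * ‖w‖) ^ n * ‖𝓕 χ w‖
      = A ^ n * ((2 * Real.pi * ‖w‖) ^ n * ‖𝓕 χ w‖) := by ring
    _ ≤ A ^ n * _ := mul_le_mul_of_nonneg_left (h1.trans h2) (by positivity)
    _ = _ := by field_simp

/-! ### Fourier series of functions supported in a small ball -/

/-- The function on the torus with the values of `χ` on the cube `(-1/2, 1/2]^d`. -/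
def torusLift (χ : Eu d → ℂ) (θ : UnitAddTorus (Fin d)) : ℂ :=
  χ (WithLp.toLp 2 fun i => (AddCircle.equivIoc (1 : ℝ) (-1 / 2) (θ i) : ℝ))

theorem torusLift_coe (χ : Eu d → ℂ) {u : Fin d → ℝ}
    (hu : ∀ i, u i ∈ Set.Ioc (-1 / 2 : ℝ) (-1 / 2 + 1)) :
    torusLift χ (fun i => (u i : UnitAddCircle)) = χ (WithLp.toLp 2 u) := by
  unfold torusLift
  congr 2
  funext i
  rw [AddCircle.equivIoc_coe_eq (hu i)]

/-- The support stays away from the faces of the cube, so gluing opposite faces creates no jump. -/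
theorem continuous_torusLift {χ : Eu d → ℂ} (hχ : Continuous χ)
    (hsupp : tsupport χ ⊆ Metric.closedBall 0 (1 / 4)) : Continuous (torusLift χ) := by
  rw [continuous_iff_continuousAt]
  intro θ
  by_cases h : ∀ i, θ i ≠ ((-1 / 2 : ℝ) : UnitAddCircle)
  · refine hχ.continuousAt.comp ((PiLp.continuous_toLp 2 _).continuousAt.comp ?_)
    refine continuousAt_pi.2 fun i => ?_
    exact ContinuousAt.comp (f := fun η : UnitAddTorus (Fin d) => η i) (x := θ)
      (continuous_subtype_val.continuousAt.comp
        (AddCircle.continuousAt_equivIoc (1 : ℝ) (-1 / 2) (h i))) (continuous_apply i).continuousAt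
  -- A coordinate on the seam has circle norm 1/2, and the lift vanishes on the open set where that
  -- coordinate has norm above 1/4.
  · push Not at h
    obtain ⟨i, hi⟩ := h
    have hopen : IsOpen {η : UnitAddTorus (Fin d) | 1 / 4 < ‖η i‖} :=
      isOpen_lt continuous_const (continuous_apply i).norm
    have hmem : 1 / 4 < ‖θ i‖ := by
      rw [hi, (AddCircle.norm_coe_eq_abs_iff (1 : ℝ) one_ne_zero).2 (by norm_num [abs_of_neg])]
      norm_num [abs_of_neg]
    have hz : torusLift χ =ᶠ[nhds θ] fun _ => 0 := by
      filter_upwards [hopen.mem_nhds hmem] with η hη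
      refine image_eq_zero_of_notMem_tsupport (f := χ) fun hmem' => ?_
      have h1 := hsupp hmem'
      rw [mem_closedBall_zero_iff] at h1
      have h2 := (PiLp.norm_apply_le (WithLp.toLp 2 fun i =>
        (AddCircle.equivIoc (1 : ℝ) (-1 / 2) (η i) : ℝ)) i).trans h1
      rw [Real.norm_eq_abs] at h2
      have h3 := (AddCircle.norm_coe_eq_abs_iff (1 : ℝ) one_ne_zero
        (x := (AddCircle.equivIoc (1 : ℝ) (-1 / 2) (η i) : ℝ))).2
        (h2.trans (by norm_num))
      rw [AddCircle.coe_equivIoc] at h3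
      exact absurd (h3.le.trans h2) (not_le.2 hη)
    exact continuousAt_const.congr hz.symm

theorem mFourier_coe (k : Fin d → ℤ) (u : Fin d → ℝ) :
    UnitAddTorus.mFourier k (fun i => (u i : UnitAddCircle)) =
      Complex.exp (((2 * Real.pi * inner ℝ (WithLp.toLp 2 u : Eu d) (intVec k) : ℝ) : ℂ) *
        Complex.I) := by
  simp only [UnitAddTorus.mFourier, ContinuousMap.coe_mk, fourier_coe_apply, ← Complex.exp_sum]
  congr 1
  simp only [PiLp.inner_apply, intVec_apply]
  push_cast
  rw [Finset.mul_sum, Finset.sum_mul]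
  refine Finset.sum_congr rfl fun i _ => ?_
  simp
  ring

theorem mFourierCoeff_torusLift {χ : Eu d → ℂ}
    (hsupp : tsupport χ ⊆ Metric.closedBall 0 (1 / 4)) (k : Fin d → ℤ) :
    UnitAddTorus.mFourierCoeff (torusLift χ) k = 𝓕 χ (intVec k) := by
  rw [UnitAddTorus.mFourierCoeff_eq_integral _ _ fun _ => (-1 / 2 : ℝ), Real.fourier_eq',
    ← (PiLp.volume_preserving_toLp (Fin d)).integral_comp
      (MeasurableEquiv.toLp 2 _).measurableEmbedding]
  refine Eq.trans ?_ (setIntegral_eq_integral_of_forall_compl_eq_zero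
    (s := {x : Fin d → ℝ | ∀ i, x i ∈ Set.Ioc (-1 / 2 : ℝ) (-1 / 2 + 1)}) ?_)
  · refine setIntegral_congr_fun (MeasurableSet.univ_pi' fun i =>
      (measurableSet_Ioc : MeasurableSet (Set.Ioc (-1 / 2 : ℝ) (-1 / 2 + 1)))) fun u hu => ?_
    rw [torusLift_coe χ hu, mFourier_coe]
    congr 3
    have : (intVec (-k) : Eu d) = -intVec k := by ext i; simp
    rw [this, inner_neg_right]
    push_cast
    ring
  · intro u hu
    rw [image_eq_zero_of_notMem_tsupport (f := χ), smul_zero]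
    intro hmem
    refine hu fun i => ?_
    have h1 := hsupp hmem
    rw [mem_closedBall_zero_iff] at h1
    have h2 := (PiLp.norm_apply_le (WithLp.toLp 2 u) i).trans h1
    rw [Real.norm_eq_abs, abs_le] at h2
    simp only at h2
    constructor <;> linarith [h2.1, h2.2]

theorem hasSum_fourier_intVec {χ : Eu d → ℂ} (hχ : Continuous χ)
    (hsupp : tsupport χ ⊆ Metric.closedBall 0 (1 / 4))
    (hsum : Summable fun k : Fin d → ℤ => 𝓕 χ (intVec k)) {u : Eu d} (hu : ‖u‖ ≤ 1 / 4) :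
    HasSum (fun k : Fin d → ℤ => 𝓕 χ (intVec k) *
      Complex.exp (((2 * Real.pi * inner ℝ u (intVec k) : ℝ) : ℂ) * Complex.I)) (χ u) := by
  have h := UnitAddTorus.hasSum_mFourier_series_apply_of_summable
    (f := ⟨torusLift χ, continuous_torusLift hχ hsupp⟩)
    (hsum.congr fun k => (mFourierCoeff_torusLift hsupp k).symm)
    (fun i => (u i : UnitAddCircle))
  simp only [ContinuousMap.coe_mk, mFourierCoeff_torusLift hsupp, mFourier_coe, smul_eq_mul] at h
  rw [torusLift_coe] at h
  · exact h
  · intro i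
    have h2 := (PiLp.norm_apply_le u i).trans hu
    rw [Real.norm_eq_abs, abs_le] at h2
    constructor <;> linarith [h2.1, h2.2]

variable {s : ℝ}

/-! ### Continuity estimates in terms of pointwise Gevrey bounds -/

theorem toReal_norm_le_of_gevreyNorm_le {A₀ C : ℝ} {K : Set (Eu d)} {φ : Eu d → ℂ} {z : ℂ}
    {c : NNReal} (hs : 0 ≤ s) (hA₀ : 0 < A₀) (hC : 0 ≤ C)
    (hz : gevreyNorm s A₀ K φ < ⊤ → ENNReal.ofReal ‖z‖ ≤ c * gevreyNorm s A₀ K φ)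
    (h : ∀ y ∈ K, GevreyAt s (A₀ * ((d : ℝ) ^ s + 1)) C φ y) : ‖z‖ ≤ c * C := by
  have h1 := gevreyNorm_le_ofReal hs (by positivity) h
  rw [mul_div_cancel_right₀ _ (by positivity)] at h1
  have h2 := (hz (h1.trans_lt ENNReal.ofReal_lt_top)).trans (mul_le_mul_right h1 _)
  rw [← ENNReal.ofReal_coe_nnreal, ← ENNReal.ofReal_mul c.coe_nonneg] at h2
  exact (ENNReal.ofReal_le_ofReal_iff (by positivity)).1 h2

theorem IsUltradistribution.exists_bound (hs : 0 ≤ s) {f : BeurlingD d s →ₗ[ℂ] ℂ}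
    (hf : IsUltradistribution f) {K : Set (Eu d)} (hK : IsCompact K) :
    ∃ A : ℝ, 0 < A ∧ ∃ C : ℝ, 0 ≤ C ∧ ∀ φ : BeurlingD d s, tsupport (φ : Eu d → ℂ) ⊆ K →
      ∀ M : ℝ, (∀ y, GevreyAt s A M (φ : Eu d → ℂ) y) → ‖f φ‖ ≤ C * M := by
  obtain ⟨A, hA, C, h⟩ := hf K hK
  refine ⟨A * ((d : ℝ) ^ s + 1), by positivity, C, C.coe_nonneg, fun φ hφ M hM => ?_⟩
  exact toReal_norm_le_of_gevreyNorm_le hs hA (hM 0).nonneg (fun _ => h φ hφ) fun y _ => hM y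

theorem IsCompactUltradistribution.exists_bound (hs : 0 ≤ s) {g : RoumieuE d s →ₗ[ℂ] ℂ}
    (hg : IsCompactUltradistribution g) : ∃ K : Set (Eu d), IsCompact K ∧ ∀ A : ℝ, 0 < A →
      ∃ C : ℝ, 0 ≤ C ∧ ∀ φ : RoumieuE d s, ∀ M : ℝ, 0 ≤ M →
        (∀ y ∈ K, GevreyAt s A M (φ : Eu d → ℂ) y) → ‖g φ‖ ≤ C * M := by
  obtain ⟨K, hK, h⟩ := hg
  refine ⟨K, hK, fun A hA => ?_⟩
  obtain ⟨C, h⟩ := h (A / ((d : ℝ) ^ s + 1)) (by positivity)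
  refine ⟨C, C.coe_nonneg, fun φ M hM0 hM => ?_⟩
  refine toReal_norm_le_of_gevreyNorm_le hs (A₀ := A / ((d : ℝ) ^ s + 1)) (by positivity) hM0
    (h φ) ?_
  rwa [div_mul_cancel₀ _ (by positivity)]

theorem isCompactUltradistribution_of_bound (hs : 0 ≤ s) {g : RoumieuE d s →ₗ[ℂ] ℂ}
    {K : Set (Eu d)} (hK : IsCompact K) (h : ∀ A : ℝ, 0 < A →
      ∃ C : ℝ, 0 ≤ C ∧ ∀ φ : RoumieuE d s, ∀ M : ℝ, 0 ≤ M →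
        (∀ y ∈ K, GevreyAt s A M (φ : Eu d → ℂ) y) → ‖g φ‖ ≤ C * M) : IsCompactUltradistribution g := by
  refine ⟨K, hK, fun A hA => ?_⟩
  obtain ⟨C, hC, h⟩ := h (A / (d + 1)) (by positivity)
  refine ⟨C.toNNReal, fun φ hφ => ?_⟩
  have h1 := h φ _ ENNReal.toReal_nonneg fun y hy =>
    gevreyAt_of_gevreyNorm hs hA φ.2.1 hφ hy
  refine (ENNReal.ofReal_le_ofReal h1).trans (le_of_eq ?_)
  rw [ENNReal.ofReal_mul hC, ENNReal.ofReal_toReal hφ.ne]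
  rfl

/-! ### Membership in the test function spaces -/

theorem BeurlingD.hasCompactSupport (φ : BeurlingD d s) : HasCompactSupport (φ : Eu d → ℂ) := by
  obtain ⟨_, K, hK, h, _⟩ := φ.2
  exact hK.of_isClosed_subset (isClosed_tsupport _) h

theorem BeurlingOn.mono {K L : Set (Eu d)} {φ : Eu d → ℂ} (h : BeurlingOn s L φ) (hKL : K ⊆ L) :
    BeurlingOn s K φ := fun A hA => by
  obtain ⟨C, hC, h⟩ := h A hA
  exact ⟨C, hC, fun y hy => h y (hKL hy)⟩

theorem BeurlingOn.univ_of_tsupport {K : Set (Eu d)} {φ : Eu d → ℂ} (h : BeurlingOn s K φ)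
    (hK : tsupport φ ⊆ K) : BeurlingOn s Set.univ φ := fun A hA => by
  obtain ⟨C, hC, h⟩ := h A hA
  refine ⟨C, hC, fun y _ => ?_⟩
  by_cases hy : y ∈ K
  · exact h y hy
  · exact (GevreyAt.of_notMem_tsupport fun hy' => hy (hK hy')).mono hC

theorem BeurlingOn.mul (hs : 0 ≤ s) {K : Set (Eu d)} {φ ψ : Eu d → ℂ} (hφ : ContDiff ℝ ∞ φ)
    (hψ : ContDiff ℝ ∞ ψ) (h1 : BeurlingOn s K φ) (h2 : BeurlingOn s K ψ) :
    BeurlingOn s K fun z => φ z * ψ z := fun A hA => by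
  obtain ⟨C, hC, h1⟩ := h1 (2 * A) (by positivity)
  obtain ⟨C', hC', h2⟩ := h2 (2 * A) (by positivity)
  refine ⟨C * C', by positivity, fun y hy => ?_⟩
  have := GevreyAt.mul hs (by positivity) hφ hψ (h1 y hy) (h2 y hy)
  rwa [mul_div_cancel_left₀ _ two_ne_zero] at this

theorem BeurlingD.beurlingOn (hs : 0 ≤ s) (φ : BeurlingD d s) :
    BeurlingOn s Set.univ (φ : Eu d → ℂ) := by
  obtain ⟨hφ, K, _, hφK, h⟩ := φ.2
  refine BeurlingOn.univ_of_tsupport (fun A hA => ?_) hφK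
  have h1 := h (A * (d + 1)) (by positivity)
  refine ⟨(gevreyNorm s (A * (d + 1)) K φ).toReal, ENNReal.toReal_nonneg, fun y hy => ?_⟩
  have := gevreyAt_of_gevreyNorm hs (by positivity) hφ h1 hy
  rwa [mul_div_cancel_right₀ _ (by positivity)] at this

theorem mem_BeurlingD (hs : 0 ≤ s) {φ : Eu d → ℂ} (hφ : ContDiff ℝ ∞ φ)
    (hc : HasCompactSupport φ) (h : BeurlingOn s (tsupport φ) φ) : φ ∈ BeurlingD d s := by
  refine ⟨hφ, tsupport φ, hc, subset_rfl, fun A hA => ?_⟩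
  obtain ⟨C, _, h⟩ := h (A * ((d : ℝ) ^ s + 1)) (by positivity)
  have := gevreyNorm_le_ofReal hs (by positivity) h
  rw [mul_div_cancel_right₀ _ (by positivity)] at this
  exact this.trans_lt ENNReal.ofReal_lt_top

theorem RoumieuE.exists_gevreyAt (hs : 0 ≤ s) (ψ : RoumieuE d s) {K : Set (Eu d)}
    (hK : IsCompact K) :
    ∃ A : ℝ, 0 < A ∧ ∃ M : ℝ, 0 ≤ M ∧ ∀ y ∈ K, GevreyAt s A M (ψ : Eu d → ℂ) y := by
  obtain ⟨A, hA, h⟩ := ψ.2.2 K hK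
  exact ⟨A / (d + 1), by positivity, _, ENNReal.toReal_nonneg, fun y hy =>
    gevreyAt_of_gevreyNorm hs hA ψ.2.1 h hy⟩

/-! ### Absolutely convergent series of test functions -/

/-- Termwise differentiation is justified because the derivatives of order n are dominated by the
summable p_i n!^s/A^n. -/
theorem GevreyAt.tsum {ι : Type*} {A : ℝ} (hA : 0 < A) {F : ι → Eu d → ℂ} {p : ι → ℝ}
    (hF : ∀ i, ContDiff ℝ ∞ (F i)) (hp : Summable p) (h : ∀ i y, GevreyAt s A (p i) (F i) y)
    (y : Eu d) : GevreyAt s A (∑' i, p i) (fun z => ∑' i, F i z) y := by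
  intro n
  have hv : ∀ k i y, ‖iteratedFDeriv ℝ k (F i) y‖ ≤ p i * ((k.factorial : ℝ) ^ s / A ^ k) := by
    intro k i y
    rw [← mul_div_assoc, le_div_iff₀ (by positivity), mul_comm]
    exact h i y k
  have h1 := congrFun (iteratedFDeriv_tsum (N := ⊤) hF (fun k _ => hp.mul_right _)
    (fun k i y _ => hv k i y) (k := n) le_top) y
  rw [h1]
  have h2 := tsum_of_norm_bounded (hp.hasSum.mul_right ((n.factorial : ℝ) ^ s / A ^ n))
    fun i => hv n i y
  calc _ ≤ A ^ n * ((∑' i, p i) * ((n.factorial : ℝ) ^ s / A ^ n)) := by gcongr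
    _ = _ := by field_simp

/-- The remainder of a finite partial sum is a test function supported in K whose Gevrey constant is
a tail of p, so one continuity estimate suffices. Summable constants are demanded for every A
because the radius is dictated by f. -/
theorem IsUltradistribution.hasSum_apply (hs : 0 ≤ s) {f : BeurlingD d s →ₗ[ℂ] ℂ}
    (hf : IsUltradistribution f) {K : Set (Eu d)} (hK : IsCompact K) {ι : Type*}
    {F : ι → BeurlingD d s} {ψ : BeurlingD d s} (hFK : ∀ i, tsupport (F i : Eu d → ℂ) ⊆ K)
    (hsum : ∀ y, HasSum (fun i => (F i : Eu d → ℂ) y) ((ψ : Eu d → ℂ) y))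
    (hp : ∀ A : ℝ, 0 < A → ∃ p : ι → ℝ, Summable p ∧ ∀ i y, GevreyAt s A (p i) (F i : Eu d → ℂ) y) :
    HasSum (fun i => f (F i)) (f ψ) := by
  obtain ⟨A, hA, C, hC, hb⟩ := hf.exists_bound hs hK
  obtain ⟨p, hps, hp⟩ := hp A hA
  have key : ∀ S : Finset ι, ‖∑ i ∈ S, f (F i) - f ψ‖ ≤ C * ∑' i : {i // i ∉ S}, p i := by
    intro S
    rw [norm_sub_rev, ← map_sum, ← map_sub]
    have e : ((ψ - ∑ i ∈ S, F i : BeurlingD d s) : Eu d → ℂ) =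
        fun z => ∑' i : {i // i ∉ S}, (F i : Eu d → ℂ) z := by
      funext z
      have := (hsum z).summable.sum_add_tsum_subtype_compl S
      rw [(hsum z).tsum_eq] at this
      simp only [Submodule.coe_sub, Submodule.coe_sum, Pi.sub_apply, Finset.sum_apply]
      rw [← this, add_sub_cancel_left]
    refine hb _ ?_ _ fun y => ?_
    · refine closure_minimal (fun y hy => ?_) hK.isClosed
      by_contra hyK
      refine hy ?_
      simp only [e]
      rw [show (fun i : {i // i ∉ S} => (F i : Eu d → ℂ) y) = fun _ => 0 from funext fun i =>
        image_eq_zero_of_notMem_tsupport fun h => hyK (hFK i h), tsum_zero]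
    · rw [e]
      exact GevreyAt.tsum hA (fun i : {i // i ∉ S} => (F i).2.1) (hps.subtype _)
        (fun i y => hp i y) y
  rw [HasSum, tendsto_iff_norm_sub_tendsto_zero]
  have hlim := (tendsto_tsum_compl_atTop_zero p).const_mul C
  rw [mul_zero] at hlim
  exact squeeze_zero (fun _ => norm_nonneg _) key hlim

/-! ### The atoms of the short-time Fourier transform -/

theorem GevreyAt.stftAtom (hs : 0 < s) {A C : ℝ} (hA : 0 ≤ A) {φ : Eu d → ℂ}
    (hφ : ContDiff ℝ ∞ φ) {x y : Eu d} (ξ : Eu d) (h : GevreyAt s A C φ (y - x)) :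
    GevreyAt s (A / 2) (C * Real.exp (s * (A * ‖ξ‖) ^ (1 / s))) (stftAtom φ x ξ) y :=
  GevreyAt.mul hs.le hA
    (Complex.conjCLE.contDiff.comp (hφ.comp (contDiff_id.sub contDiff_const)))
    (contDiff_character ξ) h.conj_comp_sub (.character hs hA ξ y)

/-- The atom `conj (φ (· - x)) exp(-i⟨ξ, ·⟩)` as a test function. -/
def atomD (hs : 1 < s) (φ : BeurlingD d s) (x ξ : Eu d) : BeurlingD d s :=
  ⟨stftAtom φ x ξ, stftAtom_mem_BeurlingD hs φ.2 x ξ⟩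

theorem tsupport_stftAtom_subset {φ : Eu d → ℂ} {R : ℝ}
    (hφ : tsupport φ ⊆ Metric.closedBall 0 R) (x ξ : Eu d) :
    tsupport (stftAtom φ x ξ) ⊆ Metric.closedBall x R := by
  refine closure_minimal (fun y hy => ?_) Metric.isClosed_closedBall
  have h1 : φ (y - x) ≠ 0 := fun h0 => hy (by simp [stftAtom, h0])
  have h2 := hφ (subset_tsupport φ h1)
  rwa [mem_closedBall_zero_iff, ← mem_closedBall_iff_norm] at h2

/-! ### Local Fourier expansions -/

/-- The frequencies of the Fourier series of period `T`. -/
def freq (T : ℝ) (k : Fin d → ℤ) : Eu d := (-(2 * Real.pi / T)) • intVec k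

/-- The phase factors that centre the Fourier series of period `T` at `x`. -/
def phase (T : ℝ) (x : Eu d) (k : Fin d → ℤ) : ℂ :=
  Complex.exp (((-(2 * Real.pi / T * inner ℝ x (intVec k)) : ℝ) : ℂ) * Complex.I)

/-- The Fourier coefficients of `χ` on the cube of side `T` centred at `x`. -/
def locCoeff (T : ℝ) (x : Eu d) (χ : Eu d → ℂ) (k : Fin d → ℤ) : ℂ :=
  𝓕 (fun u : Eu d => χ (x + T • u)) (intVec k)

theorem norm_phase (T : ℝ) (x : Eu d) (k : Fin d → ℤ) : ‖phase T x k‖ = 1 :=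
  Complex.norm_exp_ofReal_mul_I _

theorem norm_freq {T : ℝ} (hT : 0 < T) (k : Fin d → ℤ) :
    ‖freq T k‖ = 2 * Real.pi / T * ‖intVec k‖ := by
  rw [freq, norm_smul, norm_neg, Real.norm_of_nonneg (by positivity)]

theorem summable_exp_neg_norm_freq (hs : 1 ≤ s) {T : ℝ} (hT : 0 < T) {ε : ℝ} (hε : 0 < ε) :
    Summable fun k : Fin d → ℤ => Real.exp (-ε * ‖freq T k‖ ^ (1 / s)) := by
  have h := summable_exp_neg_norm_intVec (d := d) hs
    (ε := ε * (2 * Real.pi / T) ^ (1 / s)) (by positivity)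
  refine h.congr fun k => ?_
  rw [norm_freq hT, Real.mul_rpow (by positivity) (norm_nonneg _)]
  ring_nf

theorem tsupport_comp_add_smul_subset {χ : Eu d → ℂ} {T : ℝ} (hT : 0 < T) {x : Eu d}
    (hχ : tsupport χ ⊆ Metric.closedBall x (T / 4)) :
    tsupport (fun u : Eu d => χ (x + T • u)) ⊆ Metric.closedBall 0 (1 / 4) := by
  refine closure_minimal (fun u hu => ?_) Metric.isClosed_closedBall
  have h := hχ (subset_tsupport χ hu)
  rw [mem_closedBall_iff_norm, add_sub_cancel_left, norm_smul, Real.norm_of_nonneg hT.le] at h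
  rw [mem_closedBall_zero_iff]
  have : T * ‖u‖ ≤ T * (1 / 4) := by linarith
  exact le_of_mul_le_mul_left this hT

/-- Dilation by T divides the radius by T, and 2π‖k‖/T is the norm of the frequency, so in the
exponent the period enters only through `freq`. -/
theorem norm_locCoeff_le (hs : 0 < s) {A M T : ℝ} (hA : 0 < A) (hT : 0 < T) {x : Eu d}
    {χ : Eu d → ℂ} (hχ : ContDiff ℝ ∞ χ) (hsupp : tsupport χ ⊆ Metric.closedBall x (T / 4))
    (h : ∀ y, GevreyAt s A M χ y) (k : Fin d → ℤ) :
    ‖locCoeff T x χ k‖ ≤ 2 ^ s * (volume.real (Metric.closedBall (0 : Eu d) (1 / 4)) * M) *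
      Real.exp (-(s / 2 * A ^ (1 / s)) * ‖freq T k‖ ^ (1 / s)) := by
  have h1 := norm_fourier_mul_exp_le hs (A := A / T) (by positivity)
    (hχ.comp (contDiff_const.add (contDiff_id.const_smul T)))
    (tsupport_comp_add_smul_subset hT hsupp)
    (fun y => GevreyAt.comp_add_smul hχ hT hA.le (h _)) (intVec k)
  have e : 2 * Real.pi * (A / T) * ‖intVec k‖ = A * ‖freq T k‖ := by
    rw [norm_freq hT]; ring
  rw [e, Real.mul_rpow hA.le (norm_nonneg _), ← mul_assoc (s / 2)] at h1
  rw [neg_mul, Real.exp_neg, ← div_eq_mul_inv, le_div_iff₀ (Real.exp_pos _)]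
  exact h1

theorem hasSum_locCoeff (hs : 1 ≤ s) {A M T : ℝ} (hA : 0 < A) (hT : 0 < T) {x : Eu d}
    {χ : Eu d → ℂ} (hχ : ContDiff ℝ ∞ χ) (hsupp : tsupport χ ⊆ Metric.closedBall x (T / 4))
    (h : ∀ y, GevreyAt s A M χ y) {y : Eu d} (hy : y ∈ Metric.closedBall x (T / 4)) :
    HasSum (fun k : Fin d → ℤ => locCoeff T x χ k * (phase T x k * character (freq T k) y))
      (χ y) := by
  have hs0 : 0 < s := by linarith
  have hsum : Summable fun k : Fin d → ℤ => locCoeff T x χ k :=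
    Summable.of_norm_bounded ((summable_exp_neg_norm_freq hs hT (by positivity)).mul_left _)
      (norm_locCoeff_le hs0 hA hT hχ hsupp h)
  have hu : ‖(1 / T) • (y - x)‖ ≤ 1 / 4 := by
    rw [mem_closedBall_iff_norm] at hy
    rw [norm_smul, Real.norm_of_nonneg (by positivity), one_div_mul_eq_div, div_le_iff₀ hT]
    linarith
  have h1 := hasSum_fourier_intVec
    (hχ.comp (contDiff_const.add (contDiff_id.const_smul T))).continuous
    (tsupport_comp_add_smul_subset hT hsupp) hsum hu
  have e : x + T • (1 / T) • (y - x) = y := by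
    rw [smul_smul, mul_one_div_cancel hT.ne', one_smul, add_sub_cancel]
  simp only [Function.comp_apply, id, e] at h1
  refine h1.congr_fun fun k => ?_
  rw [locCoeff, phase, character, freq, ← Complex.exp_add]
  congr 2
  rw [inner_smul_left, inner_smul_left, inner_sub_left, real_inner_comm (intVec k) y]
  simp only [conj_trivial]
  push_cast
  ring

theorem locCoeff_add {T : ℝ} (hT : 0 < T) {x : Eu d} {χ η : Eu d → ℂ} (hχ : Continuous χ)
    (hη : Continuous η) (h1 : tsupport χ ⊆ Metric.closedBall x (T / 4))
    (h2 : tsupport η ⊆ Metric.closedBall x (T / 4)) (k : Fin d → ℤ) :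
    locCoeff T x (fun y => χ y + η y) k = locCoeff T x χ k + locCoeff T x η k := by
  have hint : ∀ {φ : Eu d → ℂ}, Continuous φ → tsupport φ ⊆ Metric.closedBall x (T / 4) →
      Integrable fun u : Eu d => φ (x + T • u) := fun hφ h =>
    Continuous.integrable_of_hasCompactSupport (by fun_prop)
      ((isCompact_closedBall _ _).of_isClosed_subset (isClosed_tsupport _)
        (tsupport_comp_add_smul_subset hT h))
  exact congrFun (VectorFourier.fourierIntegral_add Real.continuous_fourierChar
    (by exact continuous_inner) (hint hχ h1) (hint hη h2)) (intVec k)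

theorem locCoeff_smul (T : ℝ) (x : Eu d) (c : ℂ) (χ : Eu d → ℂ) (k : Fin d → ℤ) :
    locCoeff T x (fun y => c * χ y) k = c * locCoeff T x χ k :=
  congrFun (VectorFourier.fourierIntegral_const_smul _ _ _ (fun u : Eu d => χ (x + T • u)) c)
    (intVec k)

/-- Multiplying the Fourier series of χ by the window conj φ(·-x) turns characters into atoms; the
resulting series converges well enough for f to be applied termwise. -/
theorem IsUltradistribution.hasSum_locCoeff (hs : 1 < s) {f : BeurlingD d s →ₗ[ℂ] ℂ}
    (hf : IsUltradistribution f) {T : ℝ} (hT : 0 < T) {x : Eu d} {φ χ ψ : BeurlingD d s}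
    (hφ : tsupport (φ : Eu d → ℂ) ⊆ Metric.closedBall 0 (T / 4))
    (hχ : tsupport (χ : Eu d → ℂ) ⊆ Metric.closedBall x (T / 4))
    (hψ : ∀ y, (ψ : Eu d → ℂ) y =
      (starRingEnd ℂ) ((φ : Eu d → ℂ) (y - x)) * (χ : Eu d → ℂ) y) :
    HasSum (fun k : Fin d → ℤ => locCoeff T x χ k * (phase T x k * f (atomD hs φ x (freq T k))))
      (f ψ) := by
  have hs0 : 0 < s := by linarith
  have hsupp := fun k : Fin d → ℤ => tsupport_stftAtom_subset hφ x (freq T k)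
  have key := hf.hasSum_apply hs0.le (isCompact_closedBall x (T / 4)) (ψ := ψ)
    (F := fun k : Fin d → ℤ => (locCoeff T x χ k * phase T x k) • atomD hs φ x (freq T k))
    (fun k => (closure_mono (Function.support_const_smul_subset _ _)).trans (hsupp k))
    (fun y => ?_) (fun A hA => ?_)
  · refine key.congr_fun fun k => ?_
    rw [map_smul, smul_eq_mul, mul_assoc]
  · rw [hψ]
    -- The periodic series represents χ only on this ball; elsewhere the window makes both sides
    -- vanish.
    by_cases hy : y ∈ Metric.closedBall x (T / 4)
    · obtain ⟨M, _, hM⟩ := (BeurlingD.beurlingOn hs0.le χ) 1 one_pos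
      have h := (UltraSTFT.hasSum_locCoeff hs.le one_pos hT χ.2.1 hχ (fun y => hM y trivial)
        hy).mul_left ((starRingEnd ℂ) ((φ : Eu d → ℂ) (y - x)))
      refine h.congr_fun fun k => ?_
      change (locCoeff T x χ k * phase T x k) * ((starRingEnd ℂ) ((φ : Eu d → ℂ) (y - x)) *
        character (freq T k) y) = _
      ring
    · have h0 : (φ : Eu d → ℂ) (y - x) = 0 := image_eq_zero_of_notMem_tsupport fun h => hy (by
        have := hφ h
        rwa [mem_closedBall_zero_iff, ← mem_closedBall_iff_norm] at this)
      have : ∀ k : Fin d → ℤ, ((((locCoeff T x χ k * phase T x k) • atomD hs φ x (freq T k) :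
          BeurlingD d s)) : Eu d → ℂ) y = 0 := fun k => by
        simp [atomD, stftAtom, h0]
      simp only [this, h0, map_zero, zero_mul]
      exact hasSum_zero
  · obtain ⟨Cφ, hCφ, hφA⟩ := BeurlingD.beurlingOn hs0.le φ (2 * A) (by positivity)
    set b := s * (2 * A) ^ (1 / s) with hb
    have hb0 : 0 < b := by positivity
    -- At radius A the atoms have Gevrey constants growing at rate b. As χ is of Beurling type, any
    -- radius B is available; this one makes the coefficients decay at rate b + 1, leaving rate 1
    -- for summation.
    set B := (2 * (b + 1) / s) ^ s with hB
    have hB0 : 0 < B := by positivity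
    have hBe : s / 2 * B ^ (1 / s) = b + 1 := by
      rw [hB, ← Real.rpow_mul (by positivity), mul_one_div_cancel hs0.ne', Real.rpow_one]
      field_simp
    obtain ⟨M, hM0, hM⟩ := BeurlingD.beurlingOn hs0.le χ B hB0
    have hc := norm_locCoeff_le hs0 hB0 hT χ.2.1 hχ (fun y => hM y trivial)
    rw [hBe] at hc
    set D := 2 ^ s * (volume.real (Metric.closedBall (0 : Eu d) (1 / 4)) * M) with hD
    refine ⟨fun k => D * Cφ * Real.exp (-1 * ‖freq T k‖ ^ (1 / s)),
      (summable_exp_neg_norm_freq hs.le hT one_pos).mul_left _, fun k y n => ?_⟩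
    have hat := GevreyAt.stftAtom hs0 (by positivity) φ.2.1 (freq T k) (hφA (y - x) trivial)
    rw [mul_div_cancel_left₀ _ two_ne_zero] at hat
    have e := iteratedFDeriv_const_smul_apply (𝕜 := ℝ) (i := n) (x := y)
      (a := locCoeff T x χ k * phase T x k) (f := stftAtom φ x (freq T k))
      (((atomD hs φ x (freq T k)).2.1.of_le (by exact_mod_cast le_top)).contDiffAt)
    change A ^ n * ‖iteratedFDeriv ℝ n ((locCoeff T x χ k * phase T x k) •
      stftAtom φ x (freq T k)) y‖ ≤ _
    rw [e, norm_smul, norm_mul, norm_phase, mul_one]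
    calc _ = ‖locCoeff T x χ k‖ * (A ^ n * ‖iteratedFDeriv ℝ n (stftAtom φ x (freq T k)) y‖) := by
          ring
      _ ≤ (D * Real.exp (-(b + 1) * ‖freq T k‖ ^ (1 / s))) *
          (Cφ * Real.exp (s * (2 * A * ‖freq T k‖) ^ (1 / s)) * (n.factorial : ℝ) ^ s) :=
          mul_le_mul (hc k) (hat n) (by positivity) (by positivity)
      _ = D * Cφ * (Real.exp (-(b + 1) * ‖freq T k‖ ^ (1 / s)) *
          Real.exp (s * (2 * A * ‖freq T k‖) ^ (1 / s))) * (n.factorial : ℝ) ^ s := by ring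
      _ = _ := by
          rw [← Real.exp_add, Real.mul_rpow (by positivity) (norm_nonneg _), ← mul_assoc s, ← hb]
          ring_nf

/-! ### Local extensions -/

/-- The product aψ has radius A/2, so its coefficients decay at rate (s/2)(A/2)^{1/s}. Half of that
rate is spent on the growth of f, half remains. The constant does not depend on ψ or M, which yields
continuity of the local extension. -/
theorem exists_bound_locCoeff_mul (hs : 1 < s) {f : BeurlingD d s →ₗ[ℂ] ℂ} {T : ℝ} (hT : 0 < T)
    {x : Eu d} {φ a : BeurlingD d s} (ha : tsupport (a : Eu d → ℂ) ⊆ Metric.closedBall x (T / 4))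
    (hgrow : ∀ ε : ℝ, 0 < ε → ∃ C : ℝ, 0 ≤ C ∧ ∀ ξ : Eu d,
      ‖f (atomD hs φ x ξ)‖ ≤ C * Real.exp (ε * ‖ξ‖ ^ (1 / s)))
    {A : ℝ} (hA : 0 < A) : ∃ C : ℝ, 0 ≤ C ∧
    ∀ ψ : Eu d → ℂ, ContDiff ℝ ∞ ψ → ∀ M : ℝ, 0 ≤ M →
      (∀ y ∈ Metric.closedBall x (T / 4), GevreyAt s A M ψ y) → ∀ k : Fin d → ℤ,
      ‖locCoeff T x (fun y => (a : Eu d → ℂ) y * ψ y) k *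
        (phase T x k * f (atomD hs φ x (freq T k)))‖ ≤
        C * M * Real.exp (-(s / 4 * (A / 2) ^ (1 / s)) * ‖freq T k‖ ^ (1 / s)) := by
  have hs0 : 0 < s := by linarith
  obtain ⟨Ca, hCa, haA⟩ := BeurlingD.beurlingOn hs0.le a A hA
  obtain ⟨Cf, hCf, hf⟩ := hgrow (s / 4 * (A / 2) ^ (1 / s)) (by positivity)
  refine ⟨2 ^ s * volume.real (Metric.closedBall (0 : Eu d) (1 / 4)) * Ca * Cf, by positivity,
    fun ψ hψ M hM hψM k => ?_⟩
  have hsub : tsupport (fun y => (a : Eu d → ℂ) y * ψ y) ⊆ Metric.closedBall x (T / 4) :=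
    (tsupport_mul_subset_left).trans ha
  have h1 : ∀ y, GevreyAt s (A / 2) (Ca * M) (fun y => (a : Eu d → ℂ) y * ψ y) y := fun y => by
    by_cases hy : y ∈ Metric.closedBall x (T / 4)
    · exact GevreyAt.mul hs0.le hA.le a.2.1 hψ (haA y trivial) (hψM y hy)
    · exact (GevreyAt.of_notMem_tsupport fun h => hy (hsub h)).mono (by positivity)
  have h2 := norm_locCoeff_le hs0 (by positivity) hT (a.2.1.mul hψ) hsub h1 k
  rw [norm_mul, norm_mul, norm_phase, one_mul]
  refine (mul_le_mul h2 (hf _) (norm_nonneg _) (by positivity)).trans (le_of_eq ?_)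
  rw [mul_mul_mul_comm, ← Real.exp_add]
  ring_nf

theorem summable_locCoeff_mul (hs : 1 < s) {f : BeurlingD d s →ₗ[ℂ] ℂ} {T : ℝ} (hT : 0 < T)
    {x : Eu d} {φ a : BeurlingD d s} (ha : tsupport (a : Eu d → ℂ) ⊆ Metric.closedBall x (T / 4))
    (hgrow : ∀ ε : ℝ, 0 < ε → ∃ C : ℝ, 0 ≤ C ∧ ∀ ξ : Eu d,
      ‖f (atomD hs φ x ξ)‖ ≤ C * Real.exp (ε * ‖ξ‖ ^ (1 / s)))
    (ψ : RoumieuE d s) :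
    Summable fun k : Fin d → ℤ => locCoeff T x (fun y => (a : Eu d → ℂ) y * (ψ : Eu d → ℂ) y) k *
        (phase T x k * f (atomD hs φ x (freq T k))) := by
  have hs0 : 0 < s := by linarith
  obtain ⟨A, hA, M, hM, h⟩ := RoumieuE.exists_gevreyAt hs0.le ψ (isCompact_closedBall x (T / 4))
  obtain ⟨C, _, hC⟩ := exists_bound_locCoeff_mul hs hT ha hgrow hA
  exact Summable.of_norm_bounded ((summable_exp_neg_norm_freq hs.le hT (by positivity)).mul_left _)
    (hC ψ ψ.2.1 M hM h)

/-- The series expansion is taken as the definition: it converges for Roumieu ψ because any positive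
radius gives coefficients with some positive decay rate, and f on atoms grows more slowly than that.
-/
theorem exists_localExtension (hs : 1 < s) {f : BeurlingD d s →ₗ[ℂ] ℂ} {T : ℝ} (hT : 0 < T)
    {x : Eu d} {φ a : BeurlingD d s} (ha : tsupport (a : Eu d → ℂ) ⊆ Metric.closedBall x (T / 4))
    (hgrow : ∀ ε : ℝ, 0 < ε → ∃ C : ℝ, 0 ≤ C ∧ ∀ ξ : Eu d,
      ‖f (atomD hs φ x ξ)‖ ≤ C * Real.exp (ε * ‖ξ‖ ^ (1 / s))) :
    ∃ g : RoumieuE d s →ₗ[ℂ] ℂ, IsCompactUltradistribution g ∧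
    ∀ ψ : RoumieuE d s, g ψ = ∑' k : Fin d → ℤ,
      locCoeff T x (fun y => (a : Eu d → ℂ) y * (ψ : Eu d → ℂ) y) k *
        (phase T x k * f (atomD hs φ x (freq T k))) := by
  have hs0 : 0 < s := by linarith
  have hsub : ∀ ψ : Eu d → ℂ,
      tsupport (fun y => (a : Eu d → ℂ) y * ψ y) ⊆ Metric.closedBall x (T / 4) := fun ψ =>
    (tsupport_mul_subset_left).trans ha
  let g : RoumieuE d s →ₗ[ℂ] ℂ :=
    { toFun := fun ψ => ∑' k : Fin d → ℤ,
        locCoeff T x (fun y => (a : Eu d → ℂ) y * (ψ : Eu d → ℂ) y) k *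
          (phase T x k * f (atomD hs φ x (freq T k)))
      map_add' := fun ψ η => by
        rw [← (summable_locCoeff_mul hs hT ha hgrow ψ).tsum_add
          (summable_locCoeff_mul hs hT ha hgrow η)]
        refine tsum_congr fun k => ?_
        rw [← add_mul, ← locCoeff_add hT (a.2.1.mul ψ.2.1).continuous
          (a.2.1.mul η.2.1).continuous (hsub _) (hsub _)]
        simp only [Submodule.coe_add, Pi.add_apply, mul_add]
      map_smul' := fun c ψ => by
        rw [RingHom.id_apply, smul_eq_mul, ← tsum_mul_left]
        refine tsum_congr fun k => ?_
        rw [← mul_assoc c, ← locCoeff_smul]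
        simp only [Submodule.coe_smul, Pi.smul_apply, smul_eq_mul, mul_left_comm] }
  refine ⟨g, isCompactUltradistribution_of_bound hs0.le (isCompact_closedBall x (T / 4))
    fun A hA => ?_, fun _ => rfl⟩
  obtain ⟨C, hC0, hC⟩ := exists_bound_locCoeff_mul hs hT ha hgrow hA
  have hsum := summable_exp_neg_norm_freq (d := d) hs.le hT
    (ε := s / 4 * (A / 2) ^ (1 / s)) (by positivity)
  refine ⟨C * ∑' k : Fin d → ℤ, Real.exp (-(s / 4 * (A / 2) ^ (1 / s)) * ‖freq T k‖ ^ (1 / s)),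
    mul_nonneg hC0 (tsum_nonneg fun _ => (Real.exp_pos _).le), fun ψ M hM h => ?_⟩
  have := tsum_of_norm_bounded (hsum.hasSum.mul_left (C * M)) (hC ψ ψ.2.1 M hM h)
  exact this.trans (le_of_eq (by ring))

/-! ### Partitions of unity generated by a window -/

theorem finite_norm_smul_intVec_le {h : ℝ} (hh : 0 < h) (R : ℝ) :
    {j : Fin d → ℤ | ‖h • (intVec j : Eu d)‖ ≤ R}.Finite := by
  refine (Set.finite_Icc (fun _ : Fin d => -⌈R / h⌉) fun _ => ⌈R / h⌉).subset fun j hj => ?_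
  have key : ∀ i, |(j i : ℝ)| ≤ ⌈R / h⌉ := fun i => by
    have h1 := (PiLp.norm_apply_le (h • (intVec j : Eu d)) i).trans hj
    rw [PiLp.smul_apply, norm_smul, Real.norm_of_nonneg hh.le, intVec_apply,
      Real.norm_eq_abs, mul_comm, ← le_div_iff₀ hh] at h1
    exact h1.trans (Int.le_ceil _)
  refine ⟨fun i => ?_, fun i => ?_⟩
  · have := (abs_le.1 (key i)).1
    exact_mod_cast this
  · have := (abs_le.1 (key i)).2
    exact_mod_cast this

/-- Rounding each coordinate to the lattice of spacing h = r/(d+1) moves it by at most h/2, so the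
squared distance is at most dh²/4 < r². -/
theorem exists_norm_sub_smul_intVec_lt {r : ℝ} (hr : 0 < r) (y : Eu d) :
    ∃ j : Fin d → ℤ, ‖y - (r / (d + 1)) • intVec j‖ < r := by
  set h := r / (d + 1) with hh
  have hh0 : 0 < h := by positivity
  refine ⟨fun i => round (y i / h), ?_⟩
  refine lt_of_pow_lt_pow_left₀ 2 hr.le ?_
  rw [EuclideanSpace.norm_sq_eq]
  have key : ∀ i, ‖(y - h • intVec fun i => round (y i / h)) i‖ ^ 2 ≤ (h / 2) ^ 2 := fun i => by
    have h1 := abs_sub_round (y i / h)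
    have e : (y - h • intVec fun i => round (y i / h)) i = h * (y i / h - round (y i / h)) := by
      simp only [PiLp.sub_apply, PiLp.smul_apply, intVec_apply, smul_eq_mul]
      field_simp
    rw [e, norm_mul, Real.norm_of_nonneg hh0.le, Real.norm_eq_abs]
    gcongr
    nlinarith
  calc _ ≤ ∑ _i : Fin d, (h / 2) ^ 2 := Finset.sum_le_sum fun i _ => key i
    _ = d * (h / 2) ^ 2 := by simp
    _ < r ^ 2 := by
      have e : r = h * (d + 1) := by rw [hh]; field_simp
      have hd : (0 : ℝ) ≤ d := by positivity
      rw [e]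
      nlinarith [pow_pos hh0 2, mul_nonneg hd (pow_pos hh0 2).le,
        mul_nonneg (mul_nonneg hd hd) (pow_pos hh0 2).le]

theorem exists_tsupport_subset_closedBall (φ : BeurlingD d s) :
    ∃ R : ℝ, 0 < R ∧ tsupport (φ : Eu d → ℂ) ⊆ Metric.closedBall 0 R := by
  obtain ⟨R, hR⟩ := (BeurlingD.hasCompactSupport φ).isBounded.subset_closedBall (0 : Eu d)
  exact ⟨max R 1, by positivity, hR.trans (Metric.closedBall_subset_closedBall (le_max_left _ _))⟩

/-- Here m is the reciprocal of the sum of |φ(·-x_j)|². The two factors of φ play different roles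
later: the conjugated one builds atoms, the other localises the function to be expanded. -/
theorem exists_window_partition (hs : 1 < s) {φ : BeurlingD d s} (hφ : φ ≠ 0) :
    ∃ pt : (Fin d → ℤ) → Eu d, (∀ ρ : ℝ, {j | ‖pt j‖ ≤ ρ}.Finite) ∧
      ∃ m : Eu d → ℂ, ContDiff ℝ ∞ m ∧ (∀ K, IsCompact K → BeurlingOn s K m) ∧
        ∀ (y : Eu d) (S : Finset (Fin d → ℤ)), (∀ j ∉ S, (φ : Eu d → ℂ) (y - pt j) = 0) →
          ∑ j ∈ S, (starRingEnd ℂ) ((φ : Eu d → ℂ) (y - pt j)) *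
            ((φ : Eu d → ℂ) (y - pt j) * m y) = 1 := by
  have hs0 : 0 < s := by linarith
  obtain ⟨R, hR, hsupp⟩ := exists_tsupport_subset_closedBall φ
  obtain ⟨y₀, hy₀⟩ : ∃ y₀, (φ : Eu d → ℂ) y₀ ≠ 0 := by
    by_contra hcon
    push Not at hcon
    exact hφ (Subtype.ext (funext hcon))
  obtain ⟨r, hr, hball⟩ := Metric.isOpen_iff.1
    (isOpen_ne_fun φ.2.1.continuous continuous_const) y₀ hy₀
  set pt : (Fin d → ℤ) → Eu d := fun j => (r / (d + 1)) • intVec j with hpt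
  have hfin : ∀ ρ : ℝ, {j | ‖pt j‖ ≤ ρ}.Finite := finite_norm_smul_intVec_le (by positivity)
  set θ : (Fin d → ℤ) → Eu d → ℂ := fun j y =>
    (starRingEnd ℂ) ((φ : Eu d → ℂ) (y - pt j)) * (φ : Eu d → ℂ) (y - pt j) with hθ
  set Θ : Eu d → ℂ := fun y => ∑' j, θ j y with hΘ
  have hΘS : ∀ y S, (∀ j ∉ S, (φ : Eu d → ℂ) (y - pt j) = 0) → Θ y = ∑ j ∈ S, θ j y :=
    fun y S hS => tsum_eq_sum fun j hj => by simp [hθ, hS j hj]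
  -- These indices include all translates of φ that can be nonzero on the ball of radius ρ, so Θ is
  -- one fixed finite sum there.
  set U : ℝ → Finset (Fin d → ℤ) := fun ρ => (hfin (ρ + R)).toFinset with hU
  have hU0 : ∀ ρ, ∀ y ∈ Metric.ball (0 : Eu d) ρ, ∀ j ∉ U ρ, (φ : Eu d → ℂ) (y - pt j) = 0 := by
    intro ρ y hy j hj
    refine image_eq_zero_of_notMem_tsupport fun hmem => hj ?_
    have h1 := hsupp hmem
    rw [mem_closedBall_zero_iff] at h1
    rw [mem_ball_zero_iff] at hy
    simp only [hU, Set.Finite.mem_toFinset, Set.mem_ofPred_eq]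
    have := norm_sub_norm_le (pt j) y
    rw [norm_sub_rev] at this
    linarith
  have hev : ∀ ρ, ∀ y ∈ Metric.ball (0 : Eu d) ρ,
      (fun z => ∑ j ∈ U ρ, θ j z) =ᶠ[nhds y] Θ := fun ρ y hy => by
    filter_upwards [Metric.isOpen_ball.mem_nhds hy] with z hz
    exact (hΘS z _ (hU0 ρ z hz)).symm
  have hθ1 : ∀ j, ContDiff ℝ ∞ fun y => (starRingEnd ℂ) ((φ : Eu d → ℂ) (y - pt j)) := fun j =>
    Complex.conjCLE.contDiff.comp (φ.2.1.comp (contDiff_id.sub contDiff_const))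
  have hθ2 : ∀ j, ContDiff ℝ ∞ fun y => (φ : Eu d → ℂ) (y - pt j) := fun j =>
    φ.2.1.comp (contDiff_id.sub contDiff_const)
  have hθc : ∀ j, ContDiff ℝ ∞ (θ j) := fun j => (hθ1 j).mul (hθ2 j)
  have hΘc : ContDiff ℝ ∞ Θ := contDiff_iff_contDiffAt.2 fun y =>
    (ContDiff.sum fun j _ => hθc j).contDiffAt.congr_of_eventuallyEq
      (hev (‖y‖ + 1) y (by simp)).symm
  have hΘ0 : ∀ y, Θ y ≠ 0 := by
    intro y
    -- A lattice point within r of y - y₀ places y - x_j in the ball around y₀ on which φ has no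
    -- zero.
    obtain ⟨j, hj⟩ := exists_norm_sub_smul_intVec_lt hr (y - y₀)
    have hj0 : (φ : Eu d → ℂ) (y - pt j) ≠ 0 := hball (by
      rw [mem_ball_iff_norm, sub_right_comm]
      exact hj)
    have hy : y ∈ Metric.ball (0 : Eu d) (‖y‖ + 1) := by simp
    rw [hΘS y _ (hU0 _ y hy)]
    have e : ∑ j ∈ U (‖y‖ + 1), θ j y =
        ((∑ j ∈ U (‖y‖ + 1), Complex.normSq ((φ : Eu d → ℂ) (y - pt j)) : ℝ) : ℂ) := by
      push_cast
      exact Finset.sum_congr rfl fun j _ => Complex.normSq_eq_conj_mul_self.symm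
    rw [e, Ne, Complex.ofReal_eq_zero]
    refine (Finset.sum_pos' (fun j _ => Complex.normSq_nonneg _) ⟨j, ?_, ?_⟩).ne'
    · by_contra hjU
      exact hj0 (hU0 _ y hy j hjU)
    · exact Complex.normSq_pos.2 hj0
  have hΘB : ∀ ρ, BeurlingOn s (Metric.ball 0 ρ) Θ := by
    intro ρ A hA
    obtain ⟨C, hC, hφA⟩ := BeurlingD.beurlingOn hs0.le φ (2 * A) (by positivity)
    refine ⟨∑ _j ∈ U ρ, C * C, Finset.sum_nonneg fun _ _ => by positivity, fun y hy => ?_⟩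
    refine (GevreyAt.sum hA.le (fun j _ => hθc j) fun j _ => ?_).congr (hev ρ y hy)
    have := GevreyAt.mul hs0.le (by positivity) (hθ1 j) (hθ2 j)
      (hφA (y - pt j) trivial).conj_comp_sub (hφA (y - pt j) trivial).comp_sub
    rwa [mul_div_cancel_left₀ _ two_ne_zero] at this
  refine ⟨pt, hfin, fun y => (Θ y)⁻¹, hΘc.inv hΘ0, fun K hK => ?_, fun y S hS => ?_⟩
  · obtain ⟨ρ, hρ⟩ := hK.isBounded.subset_ball (0 : Eu d)
    rcases K.eq_empty_or_nonempty with rfl | hne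
    · exact fun A _ => ⟨0, le_rfl, fun y hy => hy.elim⟩
    obtain ⟨y₁, _, hmin⟩ := hK.exists_isMinOn hne hΘc.continuous.norm.continuousOn
    exact BeurlingOn.inv hs hΘc hΘ0 (norm_pos_iff.2 (hΘ0 y₁)) (fun y hy => hmin hy)
      ((hΘB ρ).mono hρ)
  · have e := hΘS y S hS
    simp only [← mul_assoc]
    rw [← Finset.sum_mul, ← e]
    exact mul_inv_cancel₀ (hΘ0 y)

/-! ### Sums of compactly supported ultradistributions -/

theorem isCompactUltradistribution_zero :
    IsCompactUltradistribution (0 : RoumieuE d s →ₗ[ℂ] ℂ) :=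
  ⟨∅, isCompact_empty, fun _ _ => ⟨0, fun _ _ => by simp⟩⟩

theorem IsCompactUltradistribution.add {f g : RoumieuE d s →ₗ[ℂ] ℂ}
    (hf : IsCompactUltradistribution f) (hg : IsCompactUltradistribution g) :
    IsCompactUltradistribution (f + g) := by
  obtain ⟨K, hK, hf⟩ := hf
  obtain ⟨L, hL, hg⟩ := hg
  refine ⟨K ∪ L, hK.union hL, fun A hA => ?_⟩
  obtain ⟨C, hC⟩ := hf A hA
  obtain ⟨C', hC'⟩ := hg A hA
  refine ⟨C + C', fun φ hφ => ?_⟩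
  have h1 : gevreyNorm s A K (φ : Eu d → ℂ) ≤ gevreyNorm s A (K ∪ L) (φ : Eu d → ℂ) :=
    gevreyNorm_mono_set Set.subset_union_left
  have h2 : gevreyNorm s A L (φ : Eu d → ℂ) ≤ gevreyNorm s A (K ∪ L) (φ : Eu d → ℂ) :=
    gevreyNorm_mono_set Set.subset_union_right
  rw [LinearMap.add_apply, ENNReal.coe_add, add_mul]
  calc ENNReal.ofReal ‖f φ + g φ‖ ≤ ENNReal.ofReal (‖f φ‖ + ‖g φ‖) :=
        ENNReal.ofReal_le_ofReal (norm_add_le _ _)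
    _ = ENNReal.ofReal ‖f φ‖ + ENNReal.ofReal ‖g φ‖ :=
        ENNReal.ofReal_add (norm_nonneg _) (norm_nonneg _)
    _ ≤ _ := add_le_add ((hC φ (h1.trans_lt hφ)).trans (by gcongr))
        ((hC' φ (h2.trans_lt hφ)).trans (by gcongr))

theorem isCompactUltradistribution_sum {ι : Type*} {S : Finset ι}
    {g : ι → RoumieuE d s →ₗ[ℂ] ℂ} (h : ∀ i, IsCompactUltradistribution (g i)) :
    IsCompactUltradistribution (∑ i ∈ S, g i) :=
  Finset.sum_induction g IsCompactUltradistribution (fun _ _ => .add)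
    isCompactUltradistribution_zero fun i _ => h i

/-! ### Extension of ultradistributions -/

theorem mul_mem_BeurlingD (hs : 0 ≤ s) {φ m : Eu d → ℂ} (hφ : φ ∈ BeurlingD d s)
    (hm : ContDiff ℝ ∞ m) (hmB : ∀ K, IsCompact K → BeurlingOn s K m) :
    (fun y => φ y * m y) ∈ BeurlingD d s := by
  have hc := BeurlingD.hasCompactSupport ⟨φ, hφ⟩
  have hsub : tsupport (fun y => φ y * m y) ⊆ tsupport φ := tsupport_mul_subset_left
  exact mem_BeurlingD hs (hφ.1.mul hm) (hc.of_isClosed_subset (isClosed_tsupport _) hsub)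
    (.mono (.mul hs hφ.1 hm ((BeurlingD.beurlingOn hs ⟨φ, hφ⟩).mono (Set.subset_univ _))
      (hmB _ hc)) hsub)

theorem tsupport_comp_sub_subset {φ : Eu d → ℂ} {R : ℝ}
    (hφ : tsupport φ ⊆ Metric.closedBall 0 R) (x : Eu d) :
    tsupport (fun y => φ (y - x)) ⊆ Metric.closedBall x R := by
  refine closure_minimal (fun y hy => ?_) Metric.isClosed_closedBall
  have h2 := hφ (subset_tsupport φ hy)
  rwa [mem_closedBall_zero_iff, ← mem_closedBall_iff_norm] at h2

theorem comp_sub_mem_BeurlingD (hs : 0 ≤ s) (φ : BeurlingD d s) (x : Eu d) :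
    (fun y => (φ : Eu d → ℂ) (y - x)) ∈ BeurlingD d s := by
  obtain ⟨R, _, hsupp⟩ := exists_tsupport_subset_closedBall φ
  refine mem_BeurlingD hs (φ.2.1.comp (contDiff_id.sub contDiff_const))
    ((isCompact_closedBall x R).of_isClosed_subset (isClosed_tsupport _)
      (tsupport_comp_sub_subset hsupp x)) fun A hA => ?_
  obtain ⟨C, hC, h⟩ := BeurlingD.beurlingOn hs φ A hA
  exact ⟨C, hC, fun y _ => (h (y - x) trivial).comp_sub⟩

theorem belongsToCompactUltradistributions_of_atom_bounds (hs : 1 < s)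
    {f : BeurlingD d s →ₗ[ℂ] ℂ} (hf : IsUltradistribution f) {φ : BeurlingD d s} (hφ : φ ≠ 0)
    {K : Set (Eu d)} (hK : IsCompact K) (hzero : ∀ x ∉ K, ∀ ξ, f (atomD hs φ x ξ) = 0)
    (hgrow : ∀ ε : ℝ, 0 < ε → ∃ C : ℝ, 0 ≤ C ∧ ∀ x ξ : Eu d,
      ‖f (atomD hs φ x ξ)‖ ≤ C * Real.exp (ε * ‖ξ‖ ^ (1 / s))) :
    BelongsToCompactUltradistributions f := by
  have hs0 : 0 ≤ s := by linarith
  obtain ⟨R, hR, hsupp⟩ := exists_tsupport_subset_closedBall φ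
  obtain ⟨pt, hfin, m, hm, hmB, hone⟩ := exists_window_partition hs hφ
  -- With period 4R the admissible ball of radius T/4 is exactly the ball of radius R containing the
  -- support of the window.
  have hT : 0 < 4 * R := by positivity
  have hTR : 4 * R / 4 = R := by ring
  let a : (Fin d → ℤ) → BeurlingD d s := fun j =>
    ⟨_, mul_mem_BeurlingD hs0 (comp_sub_mem_BeurlingD hs0 φ (pt j)) hm hmB⟩
  have ha : ∀ j, tsupport (a j : Eu d → ℂ) ⊆ Metric.closedBall (pt j) (4 * R / 4) := fun j => by
    rw [hTR]
    exact tsupport_mul_subset_left.trans (tsupport_comp_sub_subset hsupp (pt j))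
  have hg := fun j => exists_localExtension hs hT (ha j) fun ε hε => by
    obtain ⟨C, hC, h⟩ := hgrow ε hε
    exact ⟨C, hC, h (pt j)⟩
  choose g hgC hgE using hg
  obtain ⟨ρK, hρK⟩ := hK.isBounded.subset_closedBall (0 : Eu d)
  set J := (hfin ρK).toFinset with hJ
  refine ⟨∑ j ∈ J, g j, isCompactUltradistribution_sum hgC, fun ψ => ?_⟩
  obtain ⟨ρ, _, hψρ⟩ := exists_tsupport_subset_closedBall ψ
  -- The second set contains every index whose window can meet the support of ψ, so the partition
  -- identity holds there; J is included so that the two finite sums can be compared.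
  set S := J ∪ (hfin (ρ + R)).toFinset with hS
  have hψB : ∀ K, IsCompact K → BeurlingOn s K (ψ : Eu d → ℂ) := fun K _ =>
    (BeurlingD.beurlingOn hs0 ψ).mono (Set.subset_univ _)
  let χ : (Fin d → ℤ) → BeurlingD d s := fun j =>
    ⟨_, mul_mem_BeurlingD hs0 (a j).2 ψ.2.1 hψB⟩
  have hχ : ∀ j, tsupport (χ j : Eu d → ℂ) ⊆ Metric.closedBall (pt j) (4 * R / 4) := fun j =>
    tsupport_mul_subset_left.trans (ha j)
  -- The atom of frequency 0 is the conjugated translate of φ, so its regularity is already known.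
  let η : (Fin d → ℤ) → BeurlingD d s := fun j =>
    ⟨_, mul_mem_BeurlingD hs0 (χ j).2 (stftAtom_bound hs φ.2.1 (fun A hA => by
      obtain ⟨_, L, _, hL, h⟩ := φ.2
      exact (gevreyNorm_le_of_tsupport hL).trans_lt (h A hA)) (pt j) 0).1 fun L _ =>
      (BeurlingD.beurlingOn hs0 (atomD hs φ (pt j) 0)).mono (Set.subset_univ _)⟩
  have hη : ∀ j y, (η j : Eu d → ℂ) y =
      (starRingEnd ℂ) ((φ : Eu d → ℂ) (y - pt j)) * (χ j : Eu d → ℂ) y := fun j y => by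
    change (χ j : Eu d → ℂ) y * stftAtom φ (pt j) 0 y = _
    simp [stftAtom, character, mul_comm]
  have hsum : ψ = ∑ j ∈ S, η j := by
    refine Subtype.ext (funext fun y => ?_)
    rw [Submodule.coe_sum, Finset.sum_apply]
    simp only [hη]
    change _ = ∑ j ∈ S, (starRingEnd ℂ) ((φ : Eu d → ℂ) (y - pt j)) *
      ((φ : Eu d → ℂ) (y - pt j) * m y * (ψ : Eu d → ℂ) y)
    by_cases hy : y ∈ tsupport (ψ : Eu d → ℂ)
    · simp only [← mul_assoc]
      rw [← Finset.sum_mul]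
      simp only [mul_assoc]
      rw [hone y S, one_mul]
      intro j hj
      refine image_eq_zero_of_notMem_tsupport fun hmem => hj ?_
      have h1 := hsupp hmem
      have h2 := hψρ hy
      rw [mem_closedBall_zero_iff] at h1 h2
      refine Finset.mem_union_right _ ?_
      rw [Set.Finite.mem_toFinset, Set.mem_ofPred_eq]
      have := norm_sub_norm_le (pt j) y
      rw [norm_sub_rev] at this
      linarith
    · simp [image_eq_zero_of_notMem_tsupport hy]
  have hval : ∀ j, f (η j) = g j ⟨ψ, BeurlingD_le_RoumieuE d s ψ.2⟩ := fun j => by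
    rw [hgE]
    exact (hf.hasSum_locCoeff hs hT (hsupp.trans_eq (by rw [hTR])) (hχ j) (hη j)).tsum_eq.symm
  conv_lhs => rw [hsum]
  rw [map_sum, LinearMap.sum_apply]
  simp only [hval]
  -- For indices outside J the centre lies outside K, so f annihilates every atom in the series
  -- defining `g j`.
  refine (Finset.sum_subset Finset.subset_union_left fun j _ hj => ?_).symm
  have hpt : pt j ∉ K := fun h => hj (by
    have := hρK h
    rw [mem_closedBall_zero_iff] at this
    rwa [hJ, Set.Finite.mem_toFinset, Set.mem_ofPred_eq])
  rw [hgE]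
  simp [hzero _ hpt]

/-! ### Decay of windows and bounds for the short-time Fourier transform -/

theorem le_gelfandShilovNorm (A : ℝ) (φ : Eu d → ℂ) (α β : Fin d → ℕ) (x : Eu d) :
    ENNReal.ofReal (A ^ order (α + β) / (mfact α ^ s * mfact β ^ s) *
      √(1 + ‖x‖ ^ 2) ^ order α * ‖partialDeriv β φ x‖) ≤ gelfandShilovNorm s A φ :=
  le_iSup_of_le α (le_iSup_of_le β (le_iSup_of_le x le_rfl))

/-- For fixed β the weights ⟨x⟩^n B^n/n!^s, for all n together, amount to exponential decay in
‖x‖^{1/s} at a rate that grows with B. -/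
theorem exists_gevreyAt_decay (hs : 0 < s) {φ : Eu d → ℂ} (hφ : φ ∈ BeurlingS d s) {A h : ℝ}
    (hA : 0 < A) (hh : 0 < h) :
    ∃ C : ℝ, 0 ≤ C ∧ ∀ z, GevreyAt s A (C * Real.exp (-h * ‖z‖ ^ (1 / s))) φ z := by
  -- The first entry leaves radius A after the loss of d + 1; the second makes the decay rate
  -- (s/2)B^{1/s} at least h.
  set B := max (A * (d + 1)) ((2 * h / s) ^ s) with hB
  have hB0 : 0 < B := lt_max_of_lt_left (by positivity)
  have hBh : h ≤ s / 2 * B ^ (1 / s) := by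
    have h1 : ((2 * h / s) ^ s) ^ (1 / s) ≤ B ^ (1 / s) :=
      Real.rpow_le_rpow (by positivity) (le_max_right _ _) (by positivity)
    rw [← Real.rpow_mul (by positivity), mul_one_div_cancel hs.ne', Real.rpow_one] at h1
    calc h = s / 2 * (2 * h / s) := by field_simp
      _ ≤ _ := by gcongr
  set M := (gelfandShilovNorm s B φ).toReal with hM
  have hM0 : 0 ≤ M := ENNReal.toReal_nonneg
  have hbd : ∀ (α β : Fin d → ℕ) (x : Eu d), B ^ order (α + β) / (mfact α ^ s * mfact β ^ s) *
      √(1 + ‖x‖ ^ 2) ^ order α * ‖partialDeriv β φ x‖ ≤ M := fun α β x =>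
    (ENNReal.ofReal_le_iff_le_toReal (hφ.2 B hB0).ne).1 (le_gelfandShilovNorm B φ α β x)
  refine ⟨2 ^ s * M, by positivity, fun z => ?_⟩
  have hC : 0 ≤ 2 ^ s * M * Real.exp (-h * ‖z‖ ^ (1 / s)) := by positivity
  have hAB : A ≤ B / (d + 1) := by
    rw [le_div_iff₀ (by positivity)]
    exact le_max_left _ _
  refine (GevreyAt.of_partialDeriv hs.le hB0 hφ.1 hC fun β => ?_).anti hA.le hAB
  have hβ := mfact_pos β
  set v := B ^ order β / mfact β ^ s * ‖partialDeriv β φ z‖ with hv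
  have hv0 : 0 ≤ v := by positivity
  have hexp : v * Real.exp (s / 2 * (B * ‖z‖) ^ (1 / s)) ≤ 2 ^ s * M := by
    refine mul_exp_le_of_forall_pow_mul_le hs (by positivity) hv0 fun n => ?_
    -- In dimension 0 there is no multi-index of positive order, but z = 0 and the bound is trivial.
    rcases Nat.eq_zero_or_pos d with hd | hd
    · subst hd
      have hz : ‖z‖ = 0 := by rw [Subsingleton.elim z 0, norm_zero]
      have hvM : v ≤ M := by
        have := hbd 0 β z
        simpa [hv, order, mfact] using this
      rcases Nat.eq_zero_or_pos n with rfl | hn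
      · simpa using hvM
      · rw [hz, mul_zero, zero_pow hn.ne', zero_mul]
        positivity
    -- Concentrating α in one coordinate makes α! equal to n!, while the weight ⟨x⟩^n depends only
    -- on |α|.
    · set α : Fin d → ℕ := Pi.single ⟨0, hd⟩ n with hα
      have h1 : order α = n := by simp [order, hα]
      have h2 : mfact α = n.factorial := by
        rw [mfact, Finset.prod_eq_single (⟨0, hd⟩ : Fin d)]
        · simp [hα]
        · intro j _ hj
          simp [hα, hj]
        · simp
      have h3 : order (α + β) = n + order β := by
        rw [← h1]
        exact Finset.sum_add_distrib
      have h4 := hbd α β z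
      rw [h1, h2, h3] at h4
      have h5 : ‖z‖ ≤ √(1 + ‖z‖ ^ 2) := Real.le_sqrt_of_sq_le (by linarith)
      have h6 : 0 < (n.factorial : ℝ) ^ s := by positivity
      rw [← div_le_iff₀ h6]
      refine le_trans ?_ h4
      calc (B * ‖z‖) ^ n * v / (n.factorial : ℝ) ^ s
          = B ^ (n + order β) / ((n.factorial : ℝ) ^ s * mfact β ^ s) * ‖z‖ ^ n *
            ‖partialDeriv β φ z‖ := by
            rw [hv, mul_pow, pow_add]; field_simp
        _ ≤ _ := by gcongr
  rw [Real.mul_rpow hB0.le (norm_nonneg _), ← mul_assoc] at hexp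
  rw [neg_mul, Real.exp_neg, ← div_eq_mul_inv, le_div_iff₀ (Real.exp_pos _)]
  refine le_trans ?_ hexp
  gcongr

/-- Roumieu continuity lets the radius be chosen after ε: with s A^{1/s} = ε the character costs
exactly exp(ε‖ξ‖^{1/s}). -/
theorem IsCompactUltradistribution.exists_bound_stftAtom (hs : 1 < s)
    {g : RoumieuE d s →ₗ[ℂ] ℂ} (hg : IsCompactUltradistribution g) {ε : ℝ} (hε : 0 < ε) :
    ∃ K : Set (Eu d), IsCompact K ∧ ∃ A : ℝ, 0 < A ∧ ∃ C : ℝ, 0 ≤ C ∧ ∀ φ : Eu d → ℂ,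
      ContDiff ℝ ∞ φ → ∀ (x ξ : Eu d) (M : ℝ), 0 ≤ M → (∀ y ∈ K, GevreyAt s A M φ (y - x)) →
      ∀ hmem : stftAtom φ x ξ ∈ RoumieuE d s,
        ‖g ⟨stftAtom φ x ξ, hmem⟩‖ ≤ C * M * Real.exp (ε * ‖ξ‖ ^ (1 / s)) := by
  have hs0 : 0 < s := by linarith
  obtain ⟨K, hK, h⟩ := hg.exists_bound hs0.le
  have hA : 0 < (ε / s) ^ s := by positivity
  obtain ⟨C, hC, h⟩ := h ((ε / s) ^ s / 2) (by positivity)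
  refine ⟨K, hK, (ε / s) ^ s, hA, C, hC, fun φ hφ x ξ M hM hM' hmem => ?_⟩
  have e : s * ((ε / s) ^ s * ‖ξ‖) ^ (1 / s) = ε * ‖ξ‖ ^ (1 / s) := by
    rw [Real.mul_rpow hA.le (norm_nonneg _), ← Real.rpow_mul (by positivity),
      mul_one_div_cancel hs0.ne', Real.rpow_one]
    field_simp
  refine (h ⟨_, hmem⟩ (M * Real.exp (ε * ‖ξ‖ ^ (1 / s))) (by positivity) fun y hy => ?_).trans
    (le_of_eq (mul_assoc _ _ _).symm)
  rw [← e]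
  exact GevreyAt.stftAtom hs0 hA.le hφ ξ (hM' y hy)

/-- The window decays in y - x with y confined to a compact set; subadditivity of t ↦ t^{1/s}
converts this into decay in x, with a constant factor depending on that set. -/
theorem exists_bound_stftE (hs : 1 < s) {f : RoumieuE d s →ₗ[ℂ] ℂ}
    (hf : IsCompactUltradistribution f) (φ : BeurlingS d s) {h ε : ℝ} (hh : 0 < h) (hε : 0 < ε) :
    ∃ C : ℝ, 0 < C ∧ ∀ x ξ : Eu d, ‖stftE hs f φ x ξ‖ ≤
      C * (Real.exp (-h * ‖x‖ ^ (1 / s)) * Real.exp (ε * ‖ξ‖ ^ (1 / s))) := by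
  have hs0 : 0 < s := by linarith
  obtain ⟨K, hK, A, hA, C, hC, hb⟩ := hf.exists_bound_stftAtom hs hε
  obtain ⟨Cφ, hCφ, hφ⟩ := exists_gevreyAt_decay hs0 φ.2 hA hh
  obtain ⟨ρ, hρ⟩ := hK.isBounded.subset_closedBall (0 : Eu d)
  set c : ℝ := (2 * Real.pi) ^ (-(d : ℝ) / 2) with hc
  have hc0 : 0 < c := by positivity
  set D := c * (C * (Cφ * Real.exp (h * |ρ| ^ (1 / s)))) with hD
  have hD0 : 0 ≤ D := by positivity
  -- D may be 0, whereas a positive constant is asked for.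
  refine ⟨D + 1, by positivity, fun x ξ => ?_⟩
  have key := hb φ φ.2.1 x ξ
    (Cφ * Real.exp (h * |ρ| ^ (1 / s)) * Real.exp (-h * ‖x‖ ^ (1 / s))) (by positivity)
    (fun y hy => (hφ (y - x)).mono ?_) (stftAtom_mem_RoumieuE hs φ.2 x ξ)
  · rw [stftE, norm_mul, Complex.norm_of_nonneg hc0.le]
    calc _ ≤ c * _ := mul_le_mul_of_nonneg_left key hc0.le
      _ = D * (Real.exp (-h * ‖x‖ ^ (1 / s)) * Real.exp (ε * ‖ξ‖ ^ (1 / s))) := by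
        rw [hD]; ring
      _ ≤ _ := by gcongr; linarith
  · rw [mul_assoc, ← Real.exp_add]
    gcongr
    have h1 : ‖y‖ ≤ |ρ| := by
      have := hρ hy
      rw [mem_closedBall_zero_iff] at this
      exact this.trans (le_abs_self _)
    have h2 : ‖x‖ ≤ |ρ| + ‖y - x‖ := by
      have := norm_sub_le y (y - x)
      rw [sub_sub_cancel] at this
      linarith
    have h3 : ‖x‖ ^ (1 / s) ≤ |ρ| ^ (1 / s) + ‖y - x‖ ^ (1 / s) :=
      (Real.rpow_le_rpow (norm_nonneg _) h2 (by positivity)).trans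
        (rpow_add_le_rpow_add_rpow hs.le (abs_nonneg _) (norm_nonneg _))
    nlinarith

/-! ### The two directions of the characterisation -/

theorem stftD_eq (hs : 1 < s) (f : BeurlingD d s →ₗ[ℂ] ℂ) (φ : BeurlingD d s) (x ξ : Eu d) :
    stftD hs f φ x ξ =
      (((2 * Real.pi) ^ (-(d : ℝ) / 2) : ℝ) : ℂ) * f (atomD hs φ x ξ) := rfl

theorem exists_stftD_eq_zero_of_belongs (hs : 1 < s) {f : BeurlingD d s →ₗ[ℂ] ℂ}
    (hf : BelongsToCompactUltradistributions f) (φ : BeurlingD d s) :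
    ∃ K : Set (Eu d), IsCompact K ∧ ∀ x ∉ K, ∀ ξ, stftD hs f φ x ξ = 0 := by
  have hs0 : 0 < s := by linarith
  obtain ⟨g, hg, hfg⟩ := hf
  obtain ⟨K, hK, h⟩ := hg.exists_bound hs0.le
  obtain ⟨C, -, hb⟩ := h 1 one_pos
  obtain ⟨ρ, hρ⟩ := hK.isBounded.subset_closedBall (0 : Eu d)
  obtain ⟨R, -, hsupp⟩ := exists_tsupport_subset_closedBall φ
  refine ⟨Metric.closedBall 0 (ρ + R), isCompact_closedBall _ _, fun x hx ξ => ?_⟩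
  -- An atom whose support misses the carrier has Gevrey constant 0 there, so the continuity
  -- estimate forces the value 0; any radius would serve.
  have h1 := hb ⟨_, BeurlingD_le_RoumieuE d s (atomD hs φ x ξ).2⟩ 0 le_rfl fun y hy =>
    GevreyAt.of_notMem_tsupport fun hmem => hx ?_
  · rw [mul_zero, norm_le_zero_iff, ← hfg] at h1
    rw [stftD_eq, h1, mul_zero]
  · have h2 := tsupport_stftAtom_subset hsupp x ξ hmem
    have h3 := hρ hy
    rw [mem_closedBall_iff_norm] at h2
    rw [mem_closedBall_zero_iff] at h3 ⊢
    have := norm_sub_le y (y - x)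
    rw [sub_sub_cancel] at this
    linarith

theorem exists_bound_stftD_of_belongs (hs : 1 < s) {f : BeurlingD d s →ₗ[ℂ] ℂ}
    (hf : BelongsToCompactUltradistributions f) (φ : BeurlingD d s) {ε : ℝ} (hε : 0 < ε) :
    ∃ C : ℝ, 0 < C ∧ ∀ x ξ : Eu d,
      ‖stftD hs f φ x ξ‖ ≤ C * Real.exp (ε * ‖ξ‖ ^ (1 / s)) := by
  have hs0 : 0 < s := by linarith
  obtain ⟨g, hg, hfg⟩ := hf
  obtain ⟨K, _, A, hA, C, hC, hb⟩ := hg.exists_bound_stftAtom hs hε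
  obtain ⟨M, hM, hφ⟩ := BeurlingD.beurlingOn hs0.le φ A hA
  set c : ℝ := (2 * Real.pi) ^ (-(d : ℝ) / 2) with hc
  have hc0 : 0 < c := by positivity
  refine ⟨c * (C * M) + 1, by positivity, fun x ξ => ?_⟩
  have h1 := hb φ φ.2.1 x ξ M hM (fun y _ => hφ _ trivial)
    (BeurlingD_le_RoumieuE d s (atomD hs φ x ξ).2)
  rw [stftD_eq, hfg, norm_mul, Complex.norm_of_nonneg hc0.le]
  calc _ ≤ c * _ := mul_le_mul_of_nonneg_left h1 hc0.le
    _ = c * (C * M) * Real.exp (ε * ‖ξ‖ ^ (1 / s)) := by ring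
    _ ≤ _ := by gcongr; linarith

theorem belongsToCompactUltradistributions_of_stftD (hs : 1 < s) {f : BeurlingD d s →ₗ[ℂ] ℂ}
    (hf : IsUltradistribution f) {φ : BeurlingD d s} (hφ : φ ≠ 0) {K : Set (Eu d)}
    (hK : IsCompact K) (hzero : ∀ x ∉ K, ∀ ξ, stftD hs f φ x ξ = 0)
    (hgrow : ∀ ε : ℝ, 0 < ε → ∃ C : ℝ, 0 < C ∧ ∀ x ξ : Eu d,
      ‖stftD hs f φ x ξ‖ ≤ C * Real.exp (ε * ‖ξ‖ ^ (1 / s))) :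
    BelongsToCompactUltradistributions f := by
  have hc0 : (0 : ℝ) < (2 * Real.pi) ^ (-(d : ℝ) / 2) := by positivity
  refine belongsToCompactUltradistributions_of_atom_bounds hs hf hφ hK (fun x hx ξ => ?_)
    fun ε hε => ?_
  · have := hzero x hx ξ
    rw [stftD_eq, mul_eq_zero, Complex.ofReal_eq_zero] at this
    exact this.resolve_left hc0.ne'
  · obtain ⟨C, hC, h⟩ := hgrow ε hε
    refine ⟨C / (2 * Real.pi) ^ (-(d : ℝ) / 2), by positivity, fun x ξ => ?_⟩
    have := h x ξ
    rw [stftD_eq, norm_mul, Complex.norm_of_nonneg hc0.le] at this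
    rw [div_mul_eq_mul_div, le_div_iff₀ hc0, mul_comm]
    exact this

end UltraSTFT

end

open UltraSTFT in
theorem proposition3p2 (d : ℕ) (s : ℝ) (hs : 1 < s) :
    (∀ (f : RoumieuE d s →ₗ[ℂ] ℂ), IsCompactUltradistribution f →
      ∀ φ : BeurlingS d s, ∀ h : ℝ, 0 < h → ∀ ε : ℝ, 0 < ε → ∃ C : ℝ, 0 < C ∧ ∀ x ξ : EuclideanSpace ℝ (Fin d),
        ‖stftE hs f φ x ξ‖ ≤
          C * (Real.exp (-h * ‖x‖ ^ (1 / s)) * Real.exp (ε * ‖ξ‖ ^ (1 / s)))) ∧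
    (∀ (f : BeurlingD d s →ₗ[ℂ] ℂ), IsUltradistribution f →
      ∀ φ : BeurlingD d s, φ ≠ 0 →
        (BelongsToCompactUltradistributions f ↔
          (∃ K : Set (EuclideanSpace ℝ (Fin d)), IsCompact K ∧
            tsupport (fun p : EuclideanSpace ℝ (Fin d) × EuclideanSpace ℝ (Fin d) =>
              stftD hs f φ p.1 p.2) ⊆ K ×ˢ Set.univ) ∧
          ∀ ε : ℝ, 0 < ε → ∃ C : ℝ, 0 < C ∧ ∀ x ξ : EuclideanSpace ℝ (Fin d),
            ‖stftD hs f φ x ξ‖ ≤ C * Real.exp (ε * ‖ξ‖ ^ (1 / s)))) := by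
  refine ⟨fun f hf φ h hh ε hε => exists_bound_stftE hs hf φ hh hε, fun f hf φ hφ =>
    ⟨fun hfE => ⟨?_, fun ε hε => exists_bound_stftD_of_belongs hs hfE φ hε⟩, ?_⟩⟩
  · obtain ⟨K, hK, h⟩ := exists_stftD_eq_zero_of_belongs hs hfE φ
    refine ⟨K, hK, closure_minimal (fun p hp => ⟨?_, trivial⟩) (hK.isClosed.prod isClosed_univ)⟩
    by_contra hpK
    exact hp (h p.1 hpK p.2)
  · rintro ⟨⟨K, hK, hsub⟩, hgrow⟩
    refine belongsToCompactUltradistributions_of_stftD hs hf hφ hK (fun x hx ξ => ?_) hgrow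
    by_contra hne
    exact hx (hsub (subset_tsupport
      (fun p : Eu d × Eu d => stftD hs f φ p.1 p.2) (a := (x, ξ)) hne)).1
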